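/- All Lie groups are real and smooth (finite-dimensional or, more generally, modelled on Banach spaces); actions of Lie groups are smooth; $e$ is the identity, $f_{*e}$ the differential at $e$, and the Lie bracket is that of left-invariant vector fields. A Lie group crossed module $(G_1\xrightarrow{\mu}G_0)$ consists of a Lie group homomorphism $\mu$ and a smooth action $\triangleright$ of $G_0$ on $G_1$ by automorphisms with $\mu(g)\triangleright g'=gg'g^{-1}$ and $\mu(g_0\triangleright g)=g_0\,\mu(g)\,g_0^{-1}$. For such a crossed module $(H_1\xrightarrow{\partial}H_0)$, let $\mathrm{Der}(H_0,H_1)$ be the monoid of smooth $\gamma:H_0\to H_1$ with $\gamma(hh')=\gamma(h)\,(h\triangleright\gamma(h'))$, under $(\gamma_1\star\gamma_2)(h)=\gamma_1(\partial\gamma_2(h)\,h)\,\gamma_2(h)$, let $D(H_0,H_1)$ be its group of units, and let $\mathrm{Aut}(H_1,H_0,\partial)$ be the group of pairs $(\epsilon,\rho)$ of Lie group automorphisms of $H_1,H_0$ with $\partial\epsilon=\rho\partial$ and $\epsilon(h_0\triangleright h_1)=\rho(h_0)\triangleright\epsilon(h_1)$. An action of $(G_1\xrightarrow{\mu}G_0)$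 on $(H_1\xrightarrow{\partial}H_0)$ is a pair of group homomorphisms $\alpha:G_1\to D(H_0,H_1)$ and $\beta=(\beta_1,\beta_0):G_0\to\mathrm{Aut}(H_1,H_0,\partial)$, smooth in the sense that $(g_1,h_0)\mapsto\alpha(g_1)h_0$ and $(g_0,h_i)\mapsto\beta_i(g_0)h_i$ are smooth, such that $\alpha(g_1)(\partial h_1)\,h_1=\beta_1(\mu g_1)h_1$, $\ \partial(\alpha(g_1)h_0)\,h_0=\beta_0(\mu g_1)h_0$ and $\alpha(g_0\triangleright g_1)=\beta_1(g_0)\circ\alpha(g_1)\circ\beta_0(g_0)^{-1}$. A relative Rota-Baxter operator with respect to $(\alpha,\beta)$ is a pair of smooth maps $\mathcal B_i:H_i\to G_i$ $(i=1,0)$ such that $\mu\circ\mathcal B_1=\mathcal B_0\circ\partial$ and, for all $h_i,h_i'\in H_i$, $$\mathcal B_1h_1\cdot\mathcal B_1h_1'=\mathcal B_1\big(h_1\cdot\beta_1(\mu\mathcal B_1h_1)h_1'\big),\qquad \mathcal B_0h_0\cdot\mathcal B_0h_0'=\mathcal B_0\big(h_0\cdot\beta_0(\mathcal B_0h_0)h_0'\big),$$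 $$\mathcal B_0h_0\triangleright\mathcal B_1h_1=\mathcal B_1\big(h_0\triangleright(\beta_1(\mathcal B_0h_0)h_1\cdot\alpha(\mathcal B_0h_0\triangleright\mathcal B_1h_1)h_0^{-1})\big).$$ A Lie algebra crossed module $(\mathfrak h_1\xrightarrow{\bar\partial}\mathfrak h_0)$ consists of a Lie algebra homomorphism $\bar\partial$ and an action $\triangleright$ of $\mathfrak h_0$ on $\mathfrak h_1$ by derivations with $\bar\partial a\triangleright b=[a,b]$ and $\bar\partial(u\triangleright a)=[u,\bar\partial a]$. An action of $(\mathfrak g_1\xrightarrow{\bar\mu}\mathfrak g_0)$ on it consists of a linear map $\bar\alpha:\mathfrak g_1\to\mathrm{Hom}(\mathfrak h_0,\mathfrak h_1)$ and Lie algebra homomorphisms $\bar\beta_i:\mathfrak g_0\to\mathrm{Der}(\mathfrak h_i)$ such that, for all arguments, $\bar\alpha(\xi)[u,v]=u\triangleright\bar\alpha(\xi)v-v\triangleright\bar\alpha(\xi)u$, $\ \bar\partial\bar\beta_1(x)=\bar\beta_0(x)\bar\partial$, $\ \bar\beta_1(x)(u\triangleright a)=\bar\beta_0(x)u\triangleright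 a+u\triangleright\bar\beta_1(x)a$, $\ \bar\alpha([\xi,\eta])=\bar\alpha(\xi)\bar\partial\bar\alpha(\eta)-\bar\alpha(\eta)\bar\partial\bar\alpha(\xi)$, $\ \bar\alpha(\xi)\bar\partial=\bar\beta_1(\bar\mu\xi)$, $\ \bar\partial\bar\alpha(\xi)=\bar\beta_0(\bar\mu\xi)$ and $\bar\alpha(x\triangleright\xi)=\bar\beta_1(x)\bar\alpha(\xi)-\bar\alpha(\xi)\bar\beta_0(x)$. **Theorem.** Let $(\mathcal B_1,\mathcal B_0)$ be a relative Rota-Baxter operator on the Lie group crossed module $(G_1\xrightarrow{\mu}G_0)$ with respect to an action $(\alpha,\beta)$ on $(H_1\xrightarrow{\partial}H_0)$. Let $\mathfrak g_i,\mathfrak h_i$ be the Lie algebras of $G_i,H_i$, let $\bar\mu=\mu_{*e}$, $\bar\partial=\partial_{*e}$, and let $$x\triangleright\xi=\tfrac{d}{ds}\tfrac{d}{dt}\Big|_{s=t=0}\exp(sx)\triangleright\exp(t\xi)$$ define $\triangleright$ on $\mathfrak g_0\times\mathfrak g_1$, and similarly on $\mathfrak h_0\times\mathfrak h_1$. Let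 $$\bar\alpha(\xi)u=\tfrac{d}{ds}\tfrac{d}{dt}\Big|_{s=t=0}\alpha(\exp(s\xi))\exp(tu),\qquad \bar\beta_i(x)w=\tfrac{d}{ds}\tfrac{d}{dt}\Big|_{s=t=0}\beta_i(\exp(sx))\exp(tw).$$ Then $(\mathfrak g_1\xrightarrow{\bar\mu}\mathfrak g_0)$ and $(\mathfrak h_1\xrightarrow{\bar\partial}\mathfrak h_0)$ are Lie algebra crossed modules, $(\bar\alpha,\bar\beta)$ is an action of the first on the second, and $B_1=(\mathcal B_1)_{*e}$, $B_0=(\mathcal B_0)_{*e}$ form a relative Rota-Baxter operator of weight $1$ on $(\mathfrak g_1\xrightarrow{\bar\mu}\mathfrak g_0)$ with respect to $(\bar\alpha,\bar\beta)$, that is, $\bar\mu B_1=B_0\bar\partial$ and, for all $a,b\in\mathfrak h_1$ and $u,v\in\mathfrak h_0$, $$[B_1a,B_1b]=B_1\big(\bar\beta_1(\bar\mu B_1a)b-\bar\beta_1(\bar\mu B_1b)a+[a,b]\big),\qquad [B_0u,B_0v]=B_0\big(\bar\beta_0(B_0u)v-\bar\beta_0(B_0v)u+[u,v]\big),$$ $$B_0u\triangleright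 B_1a=B_1\big(\bar\beta_1(B_0u)a-\bar\alpha(B_1a)u+u\triangleright a\big).$$ -/

import Mathlib

open scoped Manifold ContDiff

noncomputable section

/-! ### Lie algebra crossed modules -/

/-- A Lie algebra crossed module `𝔥₁ → 𝔥₀`: a Lie algebra homomorphism `bd` and an action `act`
of `𝔥₀` on `𝔥₁` by derivations, such that `bd a ▷ b = [a, b]` and `bd (u ▷ a) = [u, bd a]`. -/
structure LieAlgebraCrossedModule (R 𝔥₁ 𝔥₀ : Type*) [CommRing R]
    [LieRing 𝔥₁] [LieAlgebra R 𝔥₁] [LieRing 𝔥₀] [LieAlgebra R 𝔥₀] where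
  bd : 𝔥₁ →ₗ⁅R⁆ 𝔥₀
  act : 𝔥₀ →ₗ⁅R⁆ LieDerivation R 𝔥₁ 𝔥₁
  act_bd : ∀ a b : 𝔥₁, act (bd a) b = ⁅a, b⁆
  bd_act : ∀ (u : 𝔥₀) (a : 𝔥₁), bd (act u a) = ⁅u, bd a⁆

namespace LieAlgebraCrossedModule

variable {R 𝔤₁ 𝔤₀ 𝔥₁ 𝔥₀ : Type*} [CommRing R]
  [LieRing 𝔤₁] [LieAlgebra R 𝔤₁] [LieRing 𝔤₀] [LieAlgebra R 𝔤₀]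
  [LieRing 𝔥₁] [LieAlgebra R 𝔥₁] [LieRing 𝔥₀] [LieAlgebra R 𝔥₀]

/-- An action of the Lie algebra crossed module `𝔤` on `𝔥`, that is, a morphism of crossed modules
`(alpha, beta)` from `𝔤` to the actor `Der(𝔥₀, 𝔥₁) → Der(𝔥₁, 𝔥₀, bd)`. Here
* `Der(𝔥₀, 𝔥₁)` consists of the linear maps `D : 𝔥₀ → 𝔥₁` with `D [u, v] = u ▷ D v - v ▷ D u`,
  with bracket `[D, D'] = D ∘ bd ∘ D' - D' ∘ bd ∘ D`;
* `Der(𝔥₁, 𝔥₀, bd)` consists of the pairs `(d₁, d₀)` of derivations of `𝔥₁` and `𝔥₀` with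
  `bd ∘ d₁ = d₀ ∘ bd` and `d₁ (u ▷ a) = d₀ u ▷ a + u ▷ d₁ a`, with the commutator bracket;
* `Δ D = (D ∘ bd, bd ∘ D)` and `(d₁, d₀) ▷ D = d₁ ∘ D - D ∘ d₀`. -/
structure Action (𝔤 : LieAlgebraCrossedModule R 𝔤₁ 𝔤₀)
    (𝔥 : LieAlgebraCrossedModule R 𝔥₁ 𝔥₀) where
  alpha : 𝔤₁ →ₗ[R] 𝔥₀ →ₗ[R] 𝔥₁
  beta₁ : 𝔤₀ →ₗ⁅R⁆ LieDerivation R 𝔥₁ 𝔥₁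
  beta₀ : 𝔤₀ →ₗ⁅R⁆ LieDerivation R 𝔥₀ 𝔥₀
  /-- `alpha ξ` lies in `Der(𝔥₀, 𝔥₁)`. -/
  alpha_leibniz : ∀ (ξ : 𝔤₁) (u v : 𝔥₀),
    alpha ξ ⁅u, v⁆ = 𝔥.act u (alpha ξ v) - 𝔥.act v (alpha ξ u)
  /-- `(beta₁ x, beta₀ x)` lies in `Der(𝔥₁, 𝔥₀, bd)`. -/
  bd_beta₁ : ∀ (x : 𝔤₀) (a : 𝔥₁), 𝔥.bd (beta₁ x a) = beta₀ x (𝔥.bd a)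
  beta₁_act : ∀ (x : 𝔤₀) (u : 𝔥₀) (a : 𝔥₁),
    beta₁ x (𝔥.act u a) = 𝔥.act (beta₀ x u) a + 𝔥.act u (beta₁ x a)
  /-- `alpha` preserves brackets. -/
  alpha_lie : ∀ (ξ η : 𝔤₁) (u : 𝔥₀),
    alpha ⁅ξ, η⁆ u = alpha ξ (𝔥.bd (alpha η u)) - alpha η (𝔥.bd (alpha ξ u))
  /-- `Δ ∘ alpha = beta ∘ bd`. -/
  beta₁_bd : ∀ (ξ : 𝔤₁) (a : 𝔥₁), alpha ξ (𝔥.bd a) = beta₁ (𝔤.bd ξ) a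
  beta₀_bd : ∀ (ξ : 𝔤₁) (u : 𝔥₀), 𝔥.bd (alpha ξ u) = beta₀ (𝔤.bd ξ) u
  /-- `alpha` is equivariant: `alpha (x ▷ ξ) = beta x ▷ alpha ξ`. -/
  alpha_act : ∀ (x : 𝔤₀) (ξ : 𝔤₁) (u : 𝔥₀),
    alpha (𝔤.act x ξ) u = beta₁ x (alpha ξ u) - alpha ξ (beta₀ x u)

end LieAlgebraCrossedModule

/-- Relative Rota-Baxter operators of weight `1` on the Lie algebra `𝔤`, with respect to an action
`φ` of `𝔤` on `𝔥` by derivations. -/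
def IsLieRelativeRotaBaxter {R 𝔤 𝔥 : Type*} [CommRing R]
    [LieRing 𝔤] [LieAlgebra R 𝔤] [LieRing 𝔥] [LieAlgebra R 𝔥]
    (φ : 𝔤 →ₗ⁅R⁆ LieDerivation R 𝔥 𝔥) (B : 𝔥 →ₗ[R] 𝔤) : Prop :=
  ∀ u v : 𝔥, ⁅B u, B v⁆ = B (φ (B u) v - φ (B v) u + ⁅u, v⁆)

namespace LieAlgebraCrossedModule

variable {R 𝔤₁ 𝔤₀ 𝔥₁ 𝔥₀ : Type*} [CommRing R]
  [LieRing 𝔤₁] [LieAlgebra R 𝔤₁] [LieRing 𝔤₀] [LieAlgebra R 𝔤₀]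
  [LieRing 𝔥₁] [LieAlgebra R 𝔥₁] [LieRing 𝔥₀] [LieAlgebra R 𝔥₀]
  {𝔤 : LieAlgebraCrossedModule R 𝔤₁ 𝔤₀} {𝔥 : LieAlgebraCrossedModule R 𝔥₁ 𝔥₀}

/-- Relative Rota-Baxter operators (of weight `1`) on a Lie algebra crossed module `𝔤`, with
respect to an action of `𝔤` on `𝔥`. -/
structure Action.IsRelativeRotaBaxter (φ : 𝔤.Action 𝔥)
    (B₁ : 𝔥₁ →ₗ[R] 𝔤₁) (B₀ : 𝔥₀ →ₗ[R] 𝔤₀) : Prop where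
  bd_comm : ∀ a : 𝔥₁, 𝔤.bd (B₁ a) = B₀ (𝔥.bd a)
  rotaBaxter₁ : IsLieRelativeRotaBaxter (φ.beta₁.comp 𝔤.bd) B₁
  rotaBaxter₀ : IsLieRelativeRotaBaxter φ.beta₀ B₀
  mixed : ∀ (u : 𝔥₀) (a : 𝔥₁),
    𝔤.act (B₀ u) (B₁ a) = B₁ (φ.beta₁ (B₀ u) a - φ.alpha (B₁ a) u + 𝔥.act u a)

end LieAlgebraCrossedModule

/-! ### Lie group crossed modules

Lie groups are smooth real Lie groups without boundary, modelled on a complete normed space `E`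
(for instance any finite-dimensional one). -/

/-- A Lie group crossed module `G₁ → G₀`: a Lie group homomorphism `bd` and a smooth action `act`
of `G₀` on `G₁` by automorphisms, such that `bd g ▷ g' = g g' g⁻¹` and
`bd (g₀ ▷ g) = g₀ (bd g) g₀⁻¹`. -/
structure LieGroupCrossedModule (E₁ E₀ G₁ G₀ : Type*)
    [NormedAddCommGroup E₁] [NormedSpace ℝ E₁] [NormedAddCommGroup E₀] [NormedSpace ℝ E₀]
    [TopologicalSpace G₁] [ChartedSpace E₁ G₁] [Group G₁] [LieGroup 𝓘(ℝ, E₁) ∞ G₁]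
    [TopologicalSpace G₀] [ChartedSpace E₀ G₀] [Group G₀] [LieGroup 𝓘(ℝ, E₀) ∞ G₀] where
  bd : G₁ →* G₀
  contMDiff_bd : ContMDiff 𝓘(ℝ, E₁) 𝓘(ℝ, E₀) ∞ bd
  act : G₀ →* MulAut G₁
  contMDiff_act : ContMDiff (𝓘(ℝ, E₀).prod 𝓘(ℝ, E₁)) 𝓘(ℝ, E₁) ∞
    (fun p : G₀ × G₁ => act p.1 p.2)
  act_bd : ∀ g g' : G₁, act (bd g) g' = g * g' * g⁻¹
  bd_act : ∀ (g₀ : G₀) (g : G₁), bd (act g₀ g) = g₀ * bd g * g₀⁻¹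

namespace LieGroupCrossedModule

section Actor

variable {E₁ E₀ H₁ H₀ : Type*}
  [NormedAddCommGroup E₁] [NormedSpace ℝ E₁] [NormedAddCommGroup E₀] [NormedSpace ℝ E₀]
  [TopologicalSpace H₁] [ChartedSpace E₁ H₁] [Group H₁] [LieGroup 𝓘(ℝ, E₁) ∞ H₁]
  [TopologicalSpace H₀] [ChartedSpace E₀ H₀] [Group H₀] [LieGroup 𝓘(ℝ, E₀) ∞ H₀]

/-- `Der(H₀, H₁)`: smooth maps `γ : H₀ → H₁` with `γ (h h') = γ h · (h ▷ γ h')`. -/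
@[ext]
structure Der (H : LieGroupCrossedModule E₁ E₀ H₁ H₀) where
  toFun : H₀ → H₁
  contMDiff : ContMDiff 𝓘(ℝ, E₀) 𝓘(ℝ, E₁) ∞ toFun
  map_mul : ∀ h h' : H₀, toFun (h * h') = toFun h * H.act h (toFun h')

variable (H : LieGroupCrossedModule E₁ E₀ H₁ H₀)

instance : CoeFun H.Der (fun _ => H₀ → H₁) := ⟨Der.toFun⟩

/-- The monoid structure `(γ₁ ⋆ γ₂) h = γ₁ (bd (γ₂ h) · h) · γ₂ h` on `Der(H₀, H₁)`; the unit is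
the constant map. Its group of units is `D(H₀, H₁) = (H.Der)ˣ`. -/
instance : Monoid H.Der where
  mul γ₁ γ₂ :=
    { toFun := fun h => γ₁ (H.bd (γ₂ h) * h) * γ₂ h
      contMDiff := (γ₁.contMDiff.comp ((H.contMDiff_bd.comp γ₂.contMDiff).mul contMDiff_id)).mul
        γ₂.contMDiff
      map_mul := fun h h' => by
        have e : H.bd (γ₂ (h * h')) * (h * h') =
            (H.bd (γ₂ h) * h) * (H.bd (γ₂ h') * h') := by
          rw [γ₂.map_mul, _root_.map_mul, H.bd_act]; group
        rw [e, γ₁.map_mul, γ₂.map_mul, _root_.map_mul H.act, MulAut.mul_apply, H.act_bd,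
          _root_.map_mul (H.act h)]
        group }
  one :=
    { toFun := fun _ => 1
      contMDiff := contMDiff_const
      map_mul := fun h h' => by simp }
  mul_assoc γ₁ γ₂ γ₃ := Der.ext <| funext fun h => by
    change γ₁ (H.bd (γ₂ (H.bd (γ₃ h) * h)) * (H.bd (γ₃ h) * h)) * γ₂ (H.bd (γ₃ h) * h) * γ₃ h =
      γ₁ (H.bd (γ₂ (H.bd (γ₃ h) * h) * γ₃ h) * h) * (γ₂ (H.bd (γ₃ h) * h) * γ₃ h)
    rw [_root_.map_mul H.bd, mul_assoc, mul_assoc (H.bd _)]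
  one_mul γ := Der.ext <| funext fun h => one_mul (γ h)
  mul_one γ := Der.ext <| funext fun h => by
    change γ (H.bd 1 * h) * 1 = γ h
    simp

/-- `Aut(H₁, H₀, bd)`: pairs `(ε, ρ)` of Lie group automorphisms of `H₁` and `H₀` with
`bd ∘ ε = ρ ∘ bd` and `ε (h₀ ▷ h₁) = ρ h₀ ▷ ε h₁`. -/
def aut : Subgroup (MulAut H₁ × MulAut H₀) where
  carrier := {p |
    (ContMDiff 𝓘(ℝ, E₁) 𝓘(ℝ, E₁) ∞ p.1 ∧ ContMDiff 𝓘(ℝ, E₁) 𝓘(ℝ, E₁) ∞ p.1.symm) ∧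
    (ContMDiff 𝓘(ℝ, E₀) 𝓘(ℝ, E₀) ∞ p.2 ∧ ContMDiff 𝓘(ℝ, E₀) 𝓘(ℝ, E₀) ∞ p.2.symm) ∧
    (∀ h₁, H.bd (p.1 h₁) = p.2 (H.bd h₁)) ∧
    (∀ h₀ h₁, p.1 (H.act h₀ h₁) = H.act (p.2 h₀) (p.1 h₁))}
  mul_mem' := by
    rintro p q ⟨⟨a, a'⟩, ⟨b, b'⟩, c, d⟩ ⟨⟨e, e'⟩, ⟨f, f'⟩, g, h⟩
    refine ⟨⟨a.comp e, e'.comp a'⟩, ⟨b.comp f, f'.comp b'⟩, fun h₁ => ?_, fun h₀ h₁ => ?_⟩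
    · simp [c, g]
    · simp [h, d]
  one_mem' := ⟨⟨contMDiff_id, contMDiff_id⟩, ⟨contMDiff_id, contMDiff_id⟩, fun _ => rfl,
    fun _ _ => rfl⟩
  inv_mem' := by
    rintro p ⟨⟨a, a'⟩, ⟨b, b'⟩, c, d⟩
    refine ⟨⟨a', a⟩, ⟨b', b⟩, fun h₁ => ?_, fun h₀ h₁ => ?_⟩
    · apply p.2.injective
      change p.2 (H.bd (p.1.symm h₁)) = p.2 (p.2.symm (H.bd h₁))
      rw [← c]; simp
    · apply p.1.injective
      change p.1 (p.1.symm (H.act h₀ h₁)) = p.1 (H.act (p.2.symm h₀) (p.1.symm h₁))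
      rw [d]; simp

end Actor

section Action

variable {E₁ E₀ F₁ F₀ G₁ G₀ H₁ H₀ : Type*}
  [NormedAddCommGroup E₁] [NormedSpace ℝ E₁] [NormedAddCommGroup E₀] [NormedSpace ℝ E₀]
  [NormedAddCommGroup F₁] [NormedSpace ℝ F₁] [NormedAddCommGroup F₀] [NormedSpace ℝ F₀]
  [TopologicalSpace G₁] [ChartedSpace E₁ G₁] [Group G₁] [LieGroup 𝓘(ℝ, E₁) ∞ G₁]
  [TopologicalSpace G₀] [ChartedSpace E₀ G₀] [Group G₀] [LieGroup 𝓘(ℝ, E₀) ∞ G₀]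
  [TopologicalSpace H₁] [ChartedSpace F₁ H₁] [Group H₁] [LieGroup 𝓘(ℝ, F₁) ∞ H₁]
  [TopologicalSpace H₀] [ChartedSpace F₀ H₀] [Group H₀] [LieGroup 𝓘(ℝ, F₀) ∞ H₀]

/-- An action of the Lie group crossed module `G` on `H`: a morphism of crossed modules
`(alpha, beta)` from `G` to the actor `Δ : D(H₀, H₁) → Aut(H₁, H₀, bd)`, where
`Δ γ (h₁, h₀) = (γ (bd h₁) h₁, bd (γ h₀) h₀)` and `(ε, ρ) ▷ γ = ε ∘ γ ∘ ρ⁻¹`. Smoothness of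
`alpha` and `beta` means smoothness of `(g, h) ↦ alpha g h` and `(g, h) ↦ beta g h`. -/
structure Action (G : LieGroupCrossedModule E₁ E₀ G₁ G₀)
    (H : LieGroupCrossedModule F₁ F₀ H₁ H₀) where
  alpha : G₁ →* H.Derˣ
  beta : G₀ →* H.aut
  contMDiff_alpha : ContMDiff (𝓘(ℝ, E₁).prod 𝓘(ℝ, F₀)) 𝓘(ℝ, F₁) ∞
    (fun p : G₁ × H₀ => (alpha p.1 : H.Der) p.2)
  contMDiff_beta₁ : ContMDiff (𝓘(ℝ, E₀).prod 𝓘(ℝ, F₁)) 𝓘(ℝ, F₁) ∞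
    (fun p : G₀ × H₁ => (beta p.1).1.1 p.2)
  contMDiff_beta₀ : ContMDiff (𝓘(ℝ, E₀).prod 𝓘(ℝ, F₀)) 𝓘(ℝ, F₀) ∞
    (fun p : G₀ × H₀ => (beta p.1).1.2 p.2)
  /-- `Δ ∘ alpha = beta ∘ bd`. -/
  beta₁_bd : ∀ (g : G₁) (h : H₁), (alpha g : H.Der) (H.bd h) * h = (beta (G.bd g)).1.1 h
  beta₀_bd : ∀ (g : G₁) (h : H₀), H.bd ((alpha g : H.Der) h) * h = (beta (G.bd g)).1.2 h
  /-- `alpha` is equivariant: `alpha (g₀ ▷ g) = beta g₀ ▷ alpha g`. -/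
  alpha_act : ∀ (g₀ : G₀) (g : G₁) (h : H₀),
    (alpha (G.act g₀ g) : H.Der) h =
      (beta g₀).1.1 ((alpha g : H.Der) ((beta g₀).1.2.symm h))

variable {G : LieGroupCrossedModule E₁ E₀ G₁ G₀} {H : LieGroupCrossedModule F₁ F₀ H₁ H₀}

/-- The component `G₀ → Aut(H₁)` of `beta`. -/
def Action.beta₁ (Φ : G.Action H) : G₀ →* MulAut H₁ :=
  (MonoidHom.fst _ _).comp (H.aut.subtype.comp Φ.beta)

/-- The component `G₀ → Aut(H₀)` of `beta`. -/
def Action.beta₀ (Φ : G.Action H) : G₀ →* MulAut H₀ :=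
  (MonoidHom.snd _ _).comp (H.aut.subtype.comp Φ.beta)

end Action

end LieGroupCrossedModule

/-- Relative Rota-Baxter operators on the Lie group `G`, with respect to an action `φ` of `G` on the
Lie group `H` by automorphisms. -/
structure IsRelativeRotaBaxter (E F : Type*) {G H : Type*}
    [NormedAddCommGroup E] [NormedSpace ℝ E] [NormedAddCommGroup F] [NormedSpace ℝ F]
    [TopologicalSpace G] [ChartedSpace E G] [Group G]
    [TopologicalSpace H] [ChartedSpace F H] [Group H]
    (φ : G →* MulAut H) (B : H → G) : Prop where
  contMDiff : ContMDiff 𝓘(ℝ, F) 𝓘(ℝ, E) ∞ B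
  mul_eq : ∀ h h' : H, B h * B h' = B (h * φ (B h) h')

namespace LieGroupCrossedModule

variable {E₁ E₀ F₁ F₀ G₁ G₀ H₁ H₀ : Type*}
  [NormedAddCommGroup E₁] [NormedSpace ℝ E₁] [NormedAddCommGroup E₀] [NormedSpace ℝ E₀]
  [NormedAddCommGroup F₁] [NormedSpace ℝ F₁] [NormedAddCommGroup F₀] [NormedSpace ℝ F₀]
  [TopologicalSpace G₁] [ChartedSpace E₁ G₁] [Group G₁] [LieGroup 𝓘(ℝ, E₁) ∞ G₁]
  [TopologicalSpace G₀] [ChartedSpace E₀ G₀] [Group G₀] [LieGroup 𝓘(ℝ, E₀) ∞ G₀]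
  [TopologicalSpace H₁] [ChartedSpace F₁ H₁] [Group H₁] [LieGroup 𝓘(ℝ, F₁) ∞ H₁]
  [TopologicalSpace H₀] [ChartedSpace F₀ H₀] [Group H₀] [LieGroup 𝓘(ℝ, F₀) ∞ H₀]
  {G : LieGroupCrossedModule E₁ E₀ G₁ G₀} {H : LieGroupCrossedModule F₁ F₀ H₁ H₀}

/-- Relative Rota-Baxter operators on a Lie group crossed module `G`, with respect to an action of
`G` on `H`. -/
structure Action.IsRelativeRotaBaxter (Φ : G.Action H) (B₁ : H₁ → G₁) (B₀ : H₀ → G₀) : Prop where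
  bd_comm : ∀ h : H₁, G.bd (B₁ h) = B₀ (H.bd h)
  rotaBaxter₁ : _root_.IsRelativeRotaBaxter E₁ F₁ (Φ.beta₁.comp G.bd) B₁
  rotaBaxter₀ : _root_.IsRelativeRotaBaxter E₀ F₀ Φ.beta₀ B₀
  mixed : ∀ (h₀ : H₀) (h₁ : H₁),
    G.act (B₀ h₀) (B₁ h₁) =
      B₁ (H.act h₀ (Φ.beta₁ (B₀ h₀) h₁ *
        (Φ.alpha (G.act (B₀ h₀) (B₁ h₁)) : H.Der) h₀⁻¹))

end LieGroupCrossedModule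

/-! ### Differentiation at the identity -/

/-- The Lie algebra structure on `GroupLieAlgebra 𝓘(ℝ, E) G` is available for smooth groups. -/
instance lieGroup_minSmoothness {E G : Type*} [NormedAddCommGroup E] [NormedSpace ℝ E]
    [TopologicalSpace G] [ChartedSpace E G] [Group G] [LieGroup 𝓘(ℝ, E) ∞ G] :
    LieGroup 𝓘(ℝ, E) (minSmoothness ℝ 3) G :=
  LieGroup.of_le (n := ∞) (by
    rw [minSmoothness_of_isRCLikeNormedField]
    exact ENat.LEInfty.out)

section Differential

variable {E F K G H L : Type*}
  [NormedAddCommGroup E] [NormedSpace ℝ E] [NormedAddCommGroup F] [NormedSpace ℝ F]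
  [NormedAddCommGroup K] [NormedSpace ℝ K]
  [TopologicalSpace G] [ChartedSpace E G] [Group G]
  [TopologicalSpace H] [ChartedSpace F H] [Group H]
  [TopologicalSpace L] [ChartedSpace K L] [Group L]

variable (E F) in
/-- The differential at the identity of a map `f : G → H` with `f 1 = 1`. (The tangent spaces of `H`
at `f 1` and at `1` are then the same.) -/
def diffOne (f : G → H) : GroupLieAlgebra 𝓘(ℝ, E) G →ₗ[ℝ] GroupLieAlgebra 𝓘(ℝ, F) H :=
  ContinuousLinearMap.toLinearMap (M := E) (M₂ := F) (mfderiv 𝓘(ℝ, E) 𝓘(ℝ, F) f 1)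

variable (E F K) in
/-- For `Ψ : G → H → L` with `Ψ g 1 = 1` for all `g`, the derivative at `g = 1` in the direction `x`
of the map `g ↦ (Ψ g)_{*1} u` from `G` to the vector space `T_1 L`, i.e.
`d/ds d/dt Ψ (exp (s x)) (exp (t u))` at `s = t = 0`. -/
def mixedDiffOne (Ψ : G → H → L)
    (x : GroupLieAlgebra 𝓘(ℝ, E) G) (u : GroupLieAlgebra 𝓘(ℝ, F) H) :
    GroupLieAlgebra 𝓘(ℝ, K) L :=
  mfderiv (M' := K) 𝓘(ℝ, E) 𝓘(ℝ, K) (fun g : G => diffOne F K (Ψ g) u) 1 x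

end Differential

namespace LieGroupCrossedModule

variable {E₁ E₀ F₁ F₀ G₁ G₀ H₁ H₀ : Type*}
  [NormedAddCommGroup E₁] [NormedSpace ℝ E₁] [CompleteSpace E₁]
  [NormedAddCommGroup E₀] [NormedSpace ℝ E₀] [CompleteSpace E₀]
  [NormedAddCommGroup F₁] [NormedSpace ℝ F₁] [CompleteSpace F₁]
  [NormedAddCommGroup F₀] [NormedSpace ℝ F₀] [CompleteSpace F₀]
  [TopologicalSpace G₁] [ChartedSpace E₁ G₁] [Group G₁] [LieGroup 𝓘(ℝ, E₁) ∞ G₁]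
  [TopologicalSpace G₀] [ChartedSpace E₀ G₀] [Group G₀] [LieGroup 𝓘(ℝ, E₀) ∞ G₀]
  [TopologicalSpace H₁] [ChartedSpace F₁ H₁] [Group H₁] [LieGroup 𝓘(ℝ, F₁) ∞ H₁]
  [TopologicalSpace H₀] [ChartedSpace F₀ H₀] [Group H₀] [LieGroup 𝓘(ℝ, F₀) ∞ H₀]

/-- `𝔤` is the Lie algebra crossed module of `G`: its structure maps are obtained from those of `G`
by differentiation at the identity. (They determine `𝔤`.) -/
structure IsInfinitesimal (G : LieGroupCrossedModule E₁ E₀ G₁ G₀)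
    (𝔤 : LieAlgebraCrossedModule ℝ (GroupLieAlgebra 𝓘(ℝ, E₁) G₁)
      (GroupLieAlgebra 𝓘(ℝ, E₀) G₀)) : Prop where
  bd_eq : ∀ ξ, 𝔤.bd ξ = diffOne E₁ E₀ G.bd ξ
  act_eq : ∀ x ξ, 𝔤.act x ξ = mixedDiffOne E₀ E₁ E₁ (fun g => G.act g) x ξ

/-- `φ` is the infinitesimal action of the action `Φ`: its structure maps are obtained from those of
`Φ` by differentiation at the identity. (They determine `φ`.) -/
structure Action.IsInfinitesimal
    {G : LieGroupCrossedModule E₁ E₀ G₁ G₀} {H : LieGroupCrossedModule F₁ F₀ H₁ H₀}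
    (Φ : G.Action H)
    {𝔤 : LieAlgebraCrossedModule ℝ (GroupLieAlgebra 𝓘(ℝ, E₁) G₁) (GroupLieAlgebra 𝓘(ℝ, E₀) G₀)}
    {𝔥 : LieAlgebraCrossedModule ℝ (GroupLieAlgebra 𝓘(ℝ, F₁) H₁) (GroupLieAlgebra 𝓘(ℝ, F₀) H₀)}
    (φ : 𝔤.Action 𝔥) : Prop where
  alpha_eq : ∀ ξ u, φ.alpha ξ u = mixedDiffOne E₁ F₀ F₁ (fun g => (Φ.alpha g : H.Der)) ξ u
  beta₁_eq : ∀ x a, φ.beta₁ x a = mixedDiffOne E₀ F₁ F₁ (fun g => Φ.beta₁ g) x a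
  beta₀_eq : ∀ x u, φ.beta₀ x u = mixedDiffOne E₀ F₀ F₀ (fun g => Φ.beta₀ g) x u

end LieGroupCrossedModule

end

/-!
The theorem says that the Lie functor, applied to all the structure at hand, turns group identities
into Lie algebra identities. Everything rests on one operation. For a smooth `Ψ : G × H → L` with
`Ψ g 1 = 1`, the differential `(Ψ g)_*` at the identity is an operator between fixed model spaces,
`dOne F K (Ψ g)`, and differentiating it in `g` at `1` gives a bounded bilinear map
`mixedOne E F K Ψ`. Both are computed in the preferred charts at the identities, where `mixedOne` is
a mixed second partial derivative; if moreover `Ψ 1 h = 1`, it does not depend on which argument is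
differentiated first (`PointedSmooth₂.mixedOne_flip`).

The Lie bracket is the mixed derivative of conjugation (`lie_eq_mixedOne_conjMap`): with `m` the
multiplication in the chart and `b = ∂₁∂₂ m`, the bracket of left-invariant vector fields is
`b(x, y) - b(y, x)`, and so is the mixed derivative of `c`, where `c(g, k) g = g k`.

Each identity is then an identity of maps of two group elements, differentiated by the rules
`mixedOne_mul`, `mixedOne_left_comp`, `mixedOne_comp` and `mixedOne_comp₂`. The identities with
three arguments (derivation property, compatibility of the actions with brackets, equivariance of
`alpha`) are all instances of `mixedOne_equivariant`; the Leibniz rule for `alpha ξ` is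
`mixedOne_crossedHom`. That `alpha` preserves brackets follows algebraically from its equivariance,
since `[ξ, η] = bd ξ ▷ η` and `beta (bd ξ)` is expressed through `alpha ξ`.

A Rota-Baxter operator `B` is not a homomorphism, but
`B (h · φ(B h)k · φ(B h · B k · (B h)⁻¹)h⁻¹) = B h · B k · (B h)⁻¹`, and the mixed derivative of the
argument of `B` on the left is `[u, v] + φ(B u)v - φ(B v)u` (`mixedOne_rotaBaxter`). The
identity relating `B₁` and `B₀` is differentiated directly (`mixedOne_mixed`).
-/

open Filter Topology

noncomputable section

/-! ### Mixed second derivatives in normed spaces -/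

section Calculus

variable {E F K : Type*} [NormedAddCommGroup E] [NormedSpace ℝ E]
  [NormedAddCommGroup F] [NormedSpace ℝ F] [NormedAddCommGroup K] [NormedSpace ℝ K]

/-- If `i` and `j` are the partial derivatives of `φ`, the second one being constant in `x`, then
the derivative at `x₀` of the partial derivative `x ↦ ∂_y (f ∘ φ) (x, y₀)` is the second derivative
of `f` evaluated on `i` and `j`. -/
theorem ContDiffAt.hasFDerivAt_fderiv_comp {P : Type*} [NormedAddCommGroup P] [NormedSpace ℝ P]
    {f : P → K} {φ : E → F → P} {x₀ : E} {y₀ : F} {i : E →L[ℝ] P} {j : F →L[ℝ] P}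
    (hi : HasFDerivAt (fun x => φ x y₀) i x₀) (hj : ∀ x, HasFDerivAt (φ x) j y₀)
    (hf : ContDiffAt ℝ ∞ f (φ x₀ y₀)) :
    HasFDerivAt (fun x => fderiv ℝ (fun y => f (φ x y)) y₀)
      (((ContinuousLinearMap.compL ℝ F P K).flip j) ∘L
        (fderiv ℝ (fderiv ℝ f) (φ x₀ y₀)) ∘L i) x₀ := by
  have hd : ∀ᶠ p in 𝓝 (φ x₀ y₀), DifferentiableAt ℝ f p := by
    have := (hf.of_le (m := 1) (by exact_mod_cast le_top)).eventually (by simp)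
    filter_upwards [this] with p hp using hp.differentiableAt (by simp)
  have h2 : HasFDerivAt (fderiv ℝ f) (fderiv ℝ (fderiv ℝ f) (φ x₀ y₀)) (φ x₀ y₀) :=
    ((hf.fderiv_right (m := 1) (by
      rw [one_add_one_eq_two]; exact ENat.LEInfty.out)).differentiableAt (by simp)).hasFDerivAt
  refine ((((ContinuousLinearMap.compL ℝ F P K).flip j).hasFDerivAt).comp x₀
    (h2.comp x₀ hi)).congr_of_eventuallyEq ?_
  filter_upwards [hi.continuousAt.eventually hd] with x hx
  exact (hx.hasFDerivAt.comp y₀ (hj x)).fderiv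

theorem ContDiffAt.hasFDerivAt_fderiv_prodMk_left {f : E × F → K} {x₀ : E} {y₀ : F}
    (hf : ContDiffAt ℝ ∞ f (x₀, y₀)) :
    HasFDerivAt (fun x => fderiv ℝ (fun y => f (x, y)) y₀)
      (((ContinuousLinearMap.compL ℝ F (E × F) K).flip (.inr ℝ E F)) ∘L
        (fderiv ℝ (fderiv ℝ f) (x₀, y₀)) ∘L .inl ℝ E F) x₀ :=
  hf.hasFDerivAt_fderiv_comp (φ := Prod.mk) (hasFDerivAt_prodMk_left x₀ y₀)
    fun x => hasFDerivAt_prodMk_right x y₀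

theorem ContDiffAt.hasFDerivAt_fderiv_prodMk_right {f : E × F → K} {x₀ : E} {y₀ : F}
    (hf : ContDiffAt ℝ ∞ f (x₀, y₀)) :
    HasFDerivAt (fun y => fderiv ℝ (fun x => f (x, y)) x₀)
      (((ContinuousLinearMap.compL ℝ E (E × F) K).flip (.inl ℝ E F)) ∘L
        (fderiv ℝ (fderiv ℝ f) (x₀, y₀)) ∘L .inr ℝ E F) y₀ :=
  hf.hasFDerivAt_fderiv_comp (φ := fun y x => (x, y)) (hasFDerivAt_prodMk_right x₀ y₀)
    fun y => hasFDerivAt_prodMk_left x₀ y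

/-- The mixed partial derivatives commute. -/
theorem ContDiffAt.fderiv_fderiv_prodMk_comm {f : E × F → K} {x₀ : E} {y₀ : F}
    (hf : ContDiffAt ℝ ∞ f (x₀, y₀)) (x : E) (y : F) :
    fderiv ℝ (fun x => fderiv ℝ (fun y => f (x, y)) y₀) x₀ x y =
      fderiv ℝ (fun y => fderiv ℝ (fun x => f (x, y)) x₀) y₀ y x := by
  rw [hf.hasFDerivAt_fderiv_prodMk_left.fderiv, hf.hasFDerivAt_fderiv_prodMk_right.fderiv]
  exact (hf.isSymmSndFDerivAt (by simpa using ENat.LEInfty.out)) (x, 0) (0, y)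

end Calculus

/-! ### The preferred chart at the identity -/

section Chart

variable {E F K V G H L : Type*}
  [NormedAddCommGroup E] [NormedSpace ℝ E] [NormedAddCommGroup F] [NormedSpace ℝ F]
  [NormedAddCommGroup K] [NormedSpace ℝ K]
  [NormedAddCommGroup V] [NormedSpace ℝ V]
  [TopologicalSpace G] [ChartedSpace E G] [Group G]
  [TopologicalSpace H] [ChartedSpace F H] [Group H]
  [TopologicalSpace L] [ChartedSpace K L] [Group L]

variable (E G) in
/-- The preferred chart of `G` at the identity. -/
abbrev chartOne : PartialEquiv G E := extChartAt 𝓘(ℝ, E) (1 : G)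

variable (E G) in
/-- The coordinates of the identity. -/
abbrev coordOne : E := chartOne E G 1

theorem chartOne_symm_coordOne : (chartOne E G).symm (coordOne E G) = 1 :=
  extChartAt_to_inv (I := 𝓘(ℝ, E)) (1 : G)

theorem eventually_chartOne_right_inv :
    ∀ᶠ z in 𝓝 (coordOne E G), chartOne E G ((chartOne E G).symm z) = z := by
  filter_upwards [extChartAt_target_mem_nhds (I := 𝓘(ℝ, E)) (1 : G)] with z hz
  exact (chartOne E G).right_inv hz

theorem eventually_chartOne_left_inv :
    ∀ᶠ g in 𝓝 (1 : G), (chartOne E G).symm (chartOne E G g) = g := by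
  filter_upwards [extChartAt_source_mem_nhds (I := 𝓘(ℝ, E)) (1 : G)] with z hz
  exact (chartOne E G).left_inv hz

theorem tendsto_chartOne_symm :
    Tendsto (chartOne E G).symm (𝓝 (coordOne E G)) (𝓝 1) := by
  have := continuousAt_extChartAt_symm (I := 𝓘(ℝ, E)) (1 : G)
  rwa [ContinuousAt, chartOne_symm_coordOne] at this

theorem contMDiffAt_chartOne_symm [IsManifold 𝓘(ℝ, E) ∞ G] :
    ContMDiffAt 𝓘(ℝ, E) 𝓘(ℝ, E) ∞ (chartOne E G).symm (coordOne E G) :=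
  (contMDiffOn_extChartAt_symm (1 : G)).contMDiffAt (extChartAt_target_mem_nhds (1 : G))

/-- The coordinate expression of a smooth map preserving identities is smooth. -/
theorem contDiffAt_chart [IsManifold 𝓘(ℝ, E) ∞ G] [IsManifold 𝓘(ℝ, F) ∞ H] {f : G → H}
    (hf : ContMDiffAt 𝓘(ℝ, E) 𝓘(ℝ, F) ∞ f 1) (h1 : f 1 = 1) :
    ContDiffAt ℝ ∞ (fun z => chartOne F H (f ((chartOne E G).symm z))) (coordOne E G) := by
  rw [← contMDiffAt_iff_contDiffAt]
  have hc : ContMDiffAt 𝓘(ℝ, F) 𝓘(ℝ, F) ∞ (chartOne F H) (f 1) := by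
    rw [h1]; exact contMDiffAt_extChartAt
  rw [← chartOne_symm_coordOne (E := E)] at hf hc
  exact hc.comp (coordOne E G) (hf.comp (coordOne E G) contMDiffAt_chartOne_symm)

/-- The two-argument version of `contDiffAt_chart`. -/
theorem contDiffAt_chart₂ [IsManifold 𝓘(ℝ, E) ∞ G] [IsManifold 𝓘(ℝ, F) ∞ H]
    [IsManifold 𝓘(ℝ, K) ∞ L] {Ψ : G → H → L}
    (hf : ContMDiff (𝓘(ℝ, E).prod 𝓘(ℝ, F)) 𝓘(ℝ, K) ∞ (fun p : G × H => Ψ p.1 p.2))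
    (h1 : Ψ 1 1 = 1) :
    ContDiffAt ℝ ∞ (fun p : E × F => chartOne K L
      (Ψ ((chartOne E G).symm p.1) ((chartOne F H).symm p.2))) (coordOne E G, coordOne F H) := by
  rw [← contMDiffAt_iff_contDiffAt]
  have hc : ContMDiffAt 𝓘(ℝ, K) 𝓘(ℝ, K) ∞ (chartOne K L) (Ψ 1 1) := by
    rw [h1]; exact contMDiffAt_extChartAt
  have hp : ContMDiffAt 𝓘(ℝ, E × F) (𝓘(ℝ, E).prod 𝓘(ℝ, F)) ∞
      (fun p : E × F => ((chartOne E G).symm p.1, (chartOne F H).symm p.2))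
      (coordOne E G, coordOne F H) :=
    (ContMDiffAt.comp (coordOne E G, coordOne F H) (g := (chartOne E G).symm)
      contMDiffAt_chartOne_symm contDiff_fst.contMDiff.contMDiffAt).prodMk
    (ContMDiffAt.comp (coordOne E G, coordOne F H) (g := (chartOne F H).symm)
      contMDiffAt_chartOne_symm contDiff_snd.contMDiff.contMDiffAt)
  have hΨ := hf.contMDiffAt.comp _ hp
  refine ContMDiffAt.comp (coordOne E G, coordOne F H) (g := chartOne K L) ?_ hΨ
  simpa only [Function.comp, chartOne_symm_coordOne] using hc

/-! ### First derivatives at the identity -/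

variable (E F) in
/-- The differential at the identity of a map preserving identities, as the derivative of its
expression in the preferred charts. -/
def dOne (f : G → H) : E →L[ℝ] F :=
  fderiv ℝ (fun z => chartOne F H (f ((chartOne E G).symm z))) (coordOne E G)

variable (E F) in
/-- Smooth maps preserving the identity; they need not be homomorphisms. -/
structure PointedSmooth (f : G → H) : Prop where
  contMDiff : ContMDiff 𝓘(ℝ, E) 𝓘(ℝ, F) ∞ f
  map_one : f 1 = 1

theorem PointedSmooth.tendsto {f : G → H} (hf : PointedSmooth E F f) :
    Tendsto (fun z => f ((chartOne E G).symm z)) (𝓝 (coordOne E G)) (𝓝 1) := by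
  have := hf.contMDiff.continuous.continuousAt (x := 1)
  rw [ContinuousAt, hf.map_one] at this
  exact this.comp tendsto_chartOne_symm

theorem dOne_id : dOne E E (fun g : G => g) = .id ℝ E :=
  (Filter.EventuallyEq.fderiv_eq (f := id) eventually_chartOne_right_inv).trans fderiv_id

theorem dOne_const_one : dOne E F (fun _ : G => (1 : H)) = 0 := by simp [dOne]

theorem PointedSmooth.comp {f : H → L} {g : G → H} (hf : PointedSmooth F K f)
    (hg : PointedSmooth E F g) : PointedSmooth E K (fun x => f (g x)) :=
  ⟨hf.contMDiff.comp hg.contMDiff, by rw [hg.map_one, hf.map_one]⟩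

variable (E F K) in
/-- Maps of two arguments which are smooth and preserve the identity in the second one. -/
structure PointedSmooth₂ (Ψ : G → H → L) : Prop where
  contMDiff : ContMDiff (𝓘(ℝ, E).prod 𝓘(ℝ, F)) 𝓘(ℝ, K) ∞ (fun p : G × H => Ψ p.1 p.2)
  map_one : ∀ g, Ψ g 1 = 1

omit [Group G] in
theorem PointedSmooth₂.pointedSmooth {Ψ : G → H → L} (hΨ : PointedSmooth₂ E F K Ψ) (g : G) :
    PointedSmooth F K (Ψ g) :=
  ⟨hΨ.contMDiff.comp (contMDiff_const.prodMk contMDiff_id), hΨ.map_one g⟩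

variable [IsManifold 𝓘(ℝ, E) ∞ G] [IsManifold 𝓘(ℝ, F) ∞ H] [IsManifold 𝓘(ℝ, K) ∞ L]

theorem PointedSmooth.hasFDerivAt {f : G → H} (hf : PointedSmooth E F f) :
    HasFDerivAt (fun z => chartOne F H (f ((chartOne E G).symm z))) (dOne E F f) (coordOne E G) :=
  ((contDiffAt_chart hf.contMDiff.contMDiffAt hf.map_one).differentiableAt (by simp)).hasFDerivAt

theorem dOne_comp {f : H → L} {g : G → H} (hf : PointedSmooth F K f)
    (hg : PointedSmooth E F g) :
    dOne E K (fun x => f (g x)) = dOne F K f ∘L dOne E F g := by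
  have h1 : HasFDerivAt (fun w => chartOne K L (f ((chartOne F H).symm w))) (dOne F K f)
      (chartOne F H (g ((chartOne E G).symm (coordOne E G)))) := by
    rw [chartOne_symm_coordOne, hg.map_one]; exact hf.hasFDerivAt
  refine HasFDerivAt.fderiv ((h1.comp (coordOne E G) hg.hasFDerivAt).congr_of_eventuallyEq ?_)
  filter_upwards [hg.tendsto.eventually (eventually_chartOne_left_inv (E := F))] with z hz
  simp only [Function.comp, hz]

/-- The differential at `(1, 1)` of a map of two arguments is the sum of its partial differentials,
here composed with the differential of `x ↦ (f x, g x)`. -/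
theorem dOne_comp₂ {E' G' : Type*} [NormedAddCommGroup E'] [NormedSpace ℝ E']
    [TopologicalSpace G'] [ChartedSpace E' G'] [Group G'] [IsManifold 𝓘(ℝ, E') ∞ G']
    {Ψ : G → H → L}
    (hΨ : ContMDiff (𝓘(ℝ, E).prod 𝓘(ℝ, F)) 𝓘(ℝ, K) ∞ (fun p : G × H => Ψ p.1 p.2))
    (h1 : Ψ 1 1 = 1) {f : G' → G} {g : G' → H} (hf : PointedSmooth E' E f)
    (hg : PointedSmooth E' F g) :
    dOne E' K (fun x => Ψ (f x) (g x)) =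
      dOne E K (fun x => Ψ x 1) ∘L dOne E' E f + dOne F K (Ψ 1) ∘L dOne E' F g := by
  have hd := ((contDiffAt_chart₂ hΨ h1).differentiableAt (by simp)).hasFDerivAt
  set D := fderiv ℝ (fun p : E × F => chartOne K L
      (Ψ ((chartOne E G).symm p.1) ((chartOne F H).symm p.2))) (coordOne E G, coordOne F H)
  have e1 : dOne E K (fun x => Ψ x 1) = D ∘L .inl ℝ E F := by
    have := (HasFDerivAt.comp (f := fun e => (e, coordOne F H)) (coordOne E G) hd
      (hasFDerivAt_prodMk_left (coordOne E G) (coordOne F H))).fderiv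
    simpa only [dOne, Function.comp_def, chartOne_symm_coordOne] using this
  have e2 : dOne F K (Ψ 1) = D ∘L .inr ℝ E F := by
    have := (HasFDerivAt.comp (f := fun e => (coordOne E G, e)) (coordOne F H) hd
      (hasFDerivAt_prodMk_right (coordOne E G) (coordOne F H))).fderiv
    simpa only [dOne, Function.comp_def, chartOne_symm_coordOne] using this
  have h2 : HasFDerivAt (fun p : E × F => chartOne K L
      (Ψ ((chartOne E G).symm p.1) ((chartOne F H).symm p.2))) D
      (chartOne E G (f ((chartOne E' G').symm (coordOne E' G'))),
       chartOne F H (g ((chartOne E' G').symm (coordOne E' G')))) := by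
    rw [chartOne_symm_coordOne, hf.map_one, hg.map_one]; exact hd
  refine HasFDerivAt.fderiv (f' := _) ?_
  refine HasFDerivAt.congr_of_eventuallyEq (f := (fun p : E × F => chartOne K L
      (Ψ ((chartOne E G).symm p.1) ((chartOne F H).symm p.2))) ∘ fun z =>
        (chartOne E G (f ((chartOne E' G').symm z)), chartOne F H (g ((chartOne E' G').symm z))))
      ?_ ?_
  · convert h2.comp (coordOne E' G') (hf.hasFDerivAt.prodMk hg.hasFDerivAt) using 1
    rw [e1, e2]
    ext x
    simp [← map_add]
  · filter_upwards [hg.tendsto.eventually (eventually_chartOne_left_inv (E := F)),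
      hf.tendsto.eventually (eventually_chartOne_left_inv (E := E))] with z hz hz'
    simp only [Function.comp, hz, hz']

/-- For maps preserving the identity, the chart at `f 1` used by `mfderiv` is the one at `1`. -/
theorem diffOne_eq_dOne {f : G → H} (hf : PointedSmooth E F f) (x : E) :
    diffOne E F f x = dOne E F f x := by
  have hw : writtenInExtChartAt 𝓘(ℝ, E) 𝓘(ℝ, F) 1 f =
      fun z => chartOne F H (f ((chartOne E G).symm z)) := by
    simp only [writtenInExtChartAt, hf.map_one]; rfl
  have : HasMFDerivAt 𝓘(ℝ, E) 𝓘(ℝ, F) f 1 (dOne E F f : E →L[ℝ] F) :=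
    ⟨hf.contMDiff.continuous.continuousAt, by rw [hw]; exact hf.hasFDerivAt.hasFDerivWithinAt⟩
  exact congrArg (fun D : E →L[ℝ] F => D x) this.mfderiv

/-! ### Derivatives of maps to normed spaces, and mixed derivatives -/

variable (E) in
/-- `P'` is the derivative at the identity, in the preferred chart, of `P : G → V`. -/
def HasDerivOne (P : G → V) (P' : E →L[ℝ] V) : Prop :=
  HasFDerivAt (fun z => P ((chartOne E G).symm z)) P' (coordOne E G)

theorem HasDerivOne.comp {P : H → V} {P' : F →L[ℝ] V} {f : G → H}
    (hP : HasDerivOne F P P') (hf : PointedSmooth E F f) :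
    HasDerivOne E (fun g => P (f g)) (P' ∘L dOne E F f) := by
  have h1 : HasFDerivAt (fun w => P ((chartOne F H).symm w)) P'
      (chartOne F H (f ((chartOne E G).symm (coordOne E G)))) := by
    rw [chartOne_symm_coordOne, hf.map_one]; exact hP
  refine HasFDerivAt.congr_of_eventuallyEq (h1.comp (coordOne E G) hf.hasFDerivAt) ?_
  filter_upwards [hf.tendsto.eventually (eventually_chartOne_left_inv (E := F))] with z hz
  simp only [Function.comp, hz]

omit [IsManifold 𝓘(ℝ, E) ∞ G] in
theorem HasDerivOne.mfderiv {P : G → V} {P' : E →L[ℝ] V} (hP : HasDerivOne E P P') (x : E) :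
    (mfderiv 𝓘(ℝ, E) 𝓘(ℝ, V) P 1 : E →L[ℝ] V) x = P' x := by
  have hc : ContinuousAt P 1 := by
    have h1 : ContinuousAt (chartOne E G) 1 := continuousAt_extChartAt (I := 𝓘(ℝ, E)) (1 : G)
    refine (ContinuousAt.comp (f := chartOne E G)
      (HasFDerivAt.continuousAt hP) h1).congr ?_
    filter_upwards [eventually_chartOne_left_inv (E := E) (G := G)] with g hg
    simp only [Function.comp, hg]
  have : HasMFDerivAt 𝓘(ℝ, E) 𝓘(ℝ, V) P 1 (P' : E →L[ℝ] V) := by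
    refine ⟨hc, ?_⟩
    have hw : writtenInExtChartAt 𝓘(ℝ, E) 𝓘(ℝ, V) 1 P =
      fun z => P ((chartOne E G).symm z) := by
      rfl
    rw [hw]
    exact HasFDerivAt.hasFDerivWithinAt hP
  exact congrArg (fun D : E →L[ℝ] V => D x) this.mfderiv

variable (E F K) in
/-- The derivative at the identity of the operator-valued map `g ↦ (Ψ g)_*`, in the preferred
chart. It is meaningful when `Ψ g 1 = 1` for all `g` (see `PointedSmooth₂`). -/
def mixedOne (Ψ : G → H → L) : E →L[ℝ] F →L[ℝ] K :=
  fderiv ℝ (fun z => dOne F K (Ψ ((chartOne E G).symm z))) (coordOne E G)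

theorem PointedSmooth₂.hasDerivOne {Ψ : G → H → L} (hΨ : PointedSmooth₂ E F K Ψ) :
    HasDerivOne E (fun g => dOne F K (Ψ g)) (mixedOne E F K Ψ) :=
  (contDiffAt_chart₂ hΨ.contMDiff
    (hΨ.map_one 1)).hasFDerivAt_fderiv_prodMk_left.differentiableAt.hasFDerivAt

/-- The order of differentiation is immaterial. (The right hand side is the derivative of
`h ↦ (g ↦ Ψ g h)_*` if `Ψ 1 h = 1` for all `h`.) -/
theorem PointedSmooth₂.mixedOne_flip {Ψ : G → H → L} (hΨ : PointedSmooth₂ E F K Ψ)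
    (x : E) (u : F) :
    mixedOne E F K Ψ x u = mixedOne F E K (fun h g => Ψ g h) u x :=
  (contDiffAt_chart₂ hΨ.contMDiff (hΨ.map_one 1)).fderiv_fderiv_prodMk_comm x u

theorem mixedDiffOne_eq_mixedOne {Ψ : G → H → L} (hΨ : PointedSmooth₂ E F K Ψ) (x : E) (u : F) :
    mixedDiffOne E F K Ψ x u = mixedOne E F K Ψ x u := by
  have h : HasDerivOne (V := K) E (fun g => diffOne F K (Ψ g) u)
      ((ContinuousLinearMap.apply ℝ K u) ∘L mixedOne E F K Ψ) := by
    rw [show (fun g => diffOne F K (Ψ g) u) = fun g => dOne F K (Ψ g) u from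
      funext fun g => diffOne_eq_dOne (hΨ.pointedSmooth g) u]
    exact (ContinuousLinearMap.hasFDerivAt (ContinuousLinearMap.apply ℝ K u)).comp
      (coordOne E G) hΨ.hasDerivOne
  exact h.mfderiv x

end Chart

section LieGroup

variable {E F G H : Type*}
  [NormedAddCommGroup E] [NormedSpace ℝ E] [NormedAddCommGroup F] [NormedSpace ℝ F]
  [TopologicalSpace G] [ChartedSpace E G] [Group G] [LieGroup 𝓘(ℝ, E) ∞ G]
  [TopologicalSpace H] [ChartedSpace F H] [Group H] [LieGroup 𝓘(ℝ, F) ∞ H]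

/-! ### Products, inverses and conjugation -/

omit [LieGroup 𝓘(ℝ, E) ∞ G] in
theorem PointedSmooth.mul {f g : G → H} (hf : PointedSmooth E F f) (hg : PointedSmooth E F g) :
    PointedSmooth E F (fun x => f x * g x) :=
  ⟨hf.contMDiff.mul hg.contMDiff, by rw [hf.map_one, hg.map_one, one_mul]⟩

theorem dOne_mul {f g : G → H} (hf : PointedSmooth E F f) (hg : PointedSmooth E F g) :
    dOne E F (fun x => f x * g x) = dOne E F f + dOne E F g := by
  rw [dOne_comp₂ (Ψ := fun a b : H => a * b) (contMDiff_fst.mul contMDiff_snd) (one_mul 1) hf hg]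
  simp only [mul_one, one_mul, dOne_id, ContinuousLinearMap.id_comp]

omit [LieGroup 𝓘(ℝ, E) ∞ G] in
theorem pointedSmooth_id : PointedSmooth E E (fun g : G => g) := ⟨contMDiff_id, rfl⟩

theorem pointedSmooth_inv : PointedSmooth E E (fun g : G => g⁻¹) :=
  ⟨contMDiff_inv _ _, inv_one⟩

variable (E G) in
theorem dOne_inv : dOne E E (fun g : G => g⁻¹) = -.id ℝ E := by
  have h := dOne_mul (pointedSmooth_id (E := E) (G := G)) pointedSmooth_inv
  simp only [mul_inv_cancel, dOne_const_one, dOne_id] at h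
  exact (neg_eq_of_add_eq_zero_right h.symm).symm

/-- Conjugation `(g, k) ↦ g k g⁻¹`, as a plain function of two arguments. -/
def conjMap (g k : G) : G := g * k * g⁻¹

theorem pointedSmooth₂_conjMap : PointedSmooth₂ E E E (conjMap (G := G)) :=
  ⟨(contMDiff_fst.mul contMDiff_snd).mul contMDiff_fst.inv, fun g => by simp [conjMap]⟩

/-! ### The Lie bracket -/

/-- The multiplication in the preferred chart. -/
def chartMul (E G : Type*) [NormedAddCommGroup E] [NormedSpace ℝ E]
    [TopologicalSpace G] [ChartedSpace E G] [Group G] (p : E × E) : E :=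
  chartOne E G ((chartOne E G).symm p.1 * (chartOne E G).symm p.2)

theorem contDiffAt_chartMul :
    ContDiffAt ℝ ∞ (chartMul E G) (coordOne E G, coordOne E G) :=
  contDiffAt_chart₂ (Ψ := fun a b : G => a * b) (contMDiff_fst.mul contMDiff_snd) (one_mul 1)

theorem eventually_differentiableAt_chartMul :
    ∀ᶠ p in 𝓝 (coordOne E G, coordOne E G), DifferentiableAt ℝ (chartMul E G) p := by
  have := (contDiffAt_chartMul.of_le (m := 1) (by exact_mod_cast le_top)).eventually
    (f := chartMul E G) (by simp)
  filter_upwards [this] with p hp using hp.differentiableAt (by simp)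

theorem eventually_hasDerivOne_mul_left :
    ∀ᶠ z in 𝓝 (coordOne E G),
      HasDerivOne E (fun k : G => chartOne E G ((chartOne E G).symm z * k))
        (fderiv ℝ (fun w => chartMul E G (z, w)) (coordOne E G)) := by
  filter_upwards [((Continuous.prodMk_left (coordOne E G)).tendsto (coordOne E G)).eventually
    eventually_differentiableAt_chartMul] with z hz
  exact (DifferentiableAt.comp (f := fun w => (z, w)) (coordOne E G) hz
    (hasFDerivAt_prodMk_right z (coordOne E G)).differentiableAt).hasFDerivAt

theorem eventually_hasDerivOne_mul_right :
    ∀ᶠ z in 𝓝 (coordOne E G),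
      HasDerivOne E (fun k : G => chartOne E G (k * (chartOne E G).symm z))
        (fderiv ℝ (fun w => chartMul E G (w, z)) (coordOne E G)) := by
  filter_upwards [((Continuous.prodMk_right (coordOne E G)).tendsto (coordOne E G)).eventually
    eventually_differentiableAt_chartMul] with z hz
  exact (DifferentiableAt.comp (f := fun w => (w, z)) (coordOne E G) hz
    (hasFDerivAt_prodMk_left (coordOne E G) z).differentiableAt).hasFDerivAt

omit [LieGroup 𝓘(ℝ, E) ∞ G] in
theorem fderiv_chartMul_left :
    fderiv ℝ (fun w => chartMul E G (coordOne E G, w)) (coordOne E G) = .id ℝ E := by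
  rw [← dOne_id (G := G)]
  simp only [chartMul, chartOne_symm_coordOne, one_mul, dOne]

omit [LieGroup 𝓘(ℝ, E) ∞ G] in
theorem fderiv_chartMul_right :
    fderiv ℝ (fun w => chartMul E G (w, coordOne E G)) (coordOne E G) = .id ℝ E := by
  rw [← dOne_id (G := G)]
  simp only [chartMul, chartOne_symm_coordOne, mul_one, dOne]

variable (E G) in
/-- The mixed second derivative of the multiplication in the preferred chart. -/
def chartMulMixed : E →L[ℝ] E →L[ℝ] E :=
  fderiv ℝ (fun z => fderiv ℝ (fun w => chartMul E G (z, w)) (coordOne E G)) (coordOne E G)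

/-- The mixed derivative of conjugation is the antisymmetrization of the second derivative of the
multiplication: differentiate `(g k g⁻¹) g = g k` in `k`, then in `g`. -/
theorem mixedOne_conjMap (x y : E) :
    mixedOne E E E (conjMap (G := G)) x y = chartMulMixed E G x y - chartMulMixed E G y x := by
  have hC := pointedSmooth₂_conjMap (E := E) (G := G)
  have key : ∀ᶠ z in 𝓝 (coordOne E G),
      fderiv ℝ (fun w => chartMul E G (z, w)) (coordOne E G) =
      fderiv ℝ (fun w => chartMul E G (w, z)) (coordOne E G) ∘L
        dOne E E (conjMap ((chartOne E G).symm z)) := by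
    filter_upwards [eventually_hasDerivOne_mul_left, eventually_hasDerivOne_mul_right]
      with z h1 h2
    have h3 := h2.comp (hC.pointedSmooth ((chartOne E G).symm z))
    simp only [conjMap, inv_mul_cancel_right] at h3
    exact HasFDerivAt.unique h1 h3
  have hl := (contDiffAt_chartMul (E := E)
    (G := G)).hasFDerivAt_fderiv_prodMk_left.differentiableAt.hasFDerivAt
  have hr := (contDiffAt_chartMul (E := E)
    (G := G)).hasFDerivAt_fderiv_prodMk_right.differentiableAt.hasFDerivAt
  have h := (hr.clm_comp hC.hasDerivOne).congr_of_eventuallyEq key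
  have h' := congrArg (fun D : E →L[ℝ] E →L[ℝ] E => D x y) (hl.unique h)
  have hs := (contDiffAt_chartMul (E := E) (G := G)).fderiv_fderiv_prodMk_comm y x
  have hid : dOne E E (conjMap ((chartOne E G).symm (coordOne E G))) = .id ℝ E := by
    rw [← dOne_id (G := G), chartOne_symm_coordOne]
    congr 1; ext; simp [conjMap]
  simp only [add_apply, ContinuousLinearMap.comp_apply,
    ContinuousLinearMap.compL_apply, ContinuousLinearMap.flip_apply, hid, fderiv_chartMul_right,
    ContinuousLinearMap.id_apply] at h'
  rw [← hs] at h'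
  rw [eq_sub_iff_add_eq]
  exact h'.symm

/-- The left-invariant vector field through `y`, in the preferred chart. -/
theorem eventually_mpullbackWithin_mulInvariantVectorField (y : E) :
    (VectorField.mpullbackWithin 𝓘(ℝ, E) 𝓘(ℝ, E) (chartOne E G).symm
      (mulInvariantVectorField (I := 𝓘(ℝ, E)) (G := G) y) (Set.range 𝓘(ℝ, E)) : E → E)
      =ᶠ[𝓝 (coordOne E G)]
      fun z => fderiv ℝ (fun w => chartMul E G (z, w)) (coordOne E G) y := by
  filter_upwards [eventually_hasDerivOne_mul_left,
    extChartAt_target_mem_nhds (I := 𝓘(ℝ, E)) (1 : G)] with z hz hzt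
  rw [← hz.mfderiv y]
  have : IsManifold 𝓘(ℝ, E) 1 G := IsManifold.of_le (n := ∞) (by exact_mod_cast le_top)
  have hinv := ContinuousLinearMap.inverse_eq
    (mfderivWithin_extChartAt_symm_comp_mfderiv_extChartAt (I := 𝓘(ℝ, E)) hzt)
    (mfderiv_extChartAt_comp_mfderivWithin_extChartAt_symm (I := 𝓘(ℝ, E)) hzt)
  have hg : (chartOne E G).symm z ∈ (chartAt E (1 : G)).source := by
    rw [← extChartAt_source (I := 𝓘(ℝ, E))]
    exact (chartOne E G).map_target hzt
  have hcomp := mfderiv_comp_of_eq (I := 𝓘(ℝ, E)) (I' := 𝓘(ℝ, E)) (I'' := 𝓘(ℝ, E))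
    (x := (1 : G)) (f := fun k : G => (chartOne E G).symm z * k)
    (mdifferentiableAt_extChartAt hg)
    ((contMDiff_mul_left (I := 𝓘(ℝ, E)) (n := ∞)).mdifferentiableAt (by simp)) (mul_one _)
  rw [VectorField.mpullbackWithin_apply, hinv]
  have h1 : ∀ g g' : G, g = g' → ∀ v : E,
      (mfderiv 𝓘(ℝ, E) 𝓘(ℝ, E) (chartOne E G) g : E →L[ℝ] E) v =
        (mfderiv 𝓘(ℝ, E) 𝓘(ℝ, E) (chartOne E G) g' : E →L[ℝ] E) v := by
    rintro g _ rfl v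
    rfl
  exact (h1 _ _ (mul_one _) _).symm.trans (congrArg (fun D : E →L[ℝ] E => D y) hcomp).symm

theorem lieBracket_fderiv_chartMul (x y : E) :
    VectorField.lieBracket ℝ
      (fun z => fderiv ℝ (fun w => chartMul E G (z, w)) (coordOne E G) x)
      (fun z => fderiv ℝ (fun w => chartMul E G (z, w)) (coordOne E G) y) (coordOne E G) =
    mixedOne E E E (conjMap (G := G)) x y := by
  have hl := (contDiffAt_chartMul (E := E)
    (G := G)).hasFDerivAt_fderiv_prodMk_left.differentiableAt.hasFDerivAt
  have hl' : ∀ y : E, HasFDerivAt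
      (fun z => fderiv ℝ (fun w => chartMul E G (z, w)) (coordOne E G) y)
      ((ContinuousLinearMap.apply ℝ E y) ∘L chartMulMixed E G) (coordOne E G) := fun y =>
    (ContinuousLinearMap.hasFDerivAt (ContinuousLinearMap.apply ℝ E y)).comp (coordOne E G) hl
  rw [mixedOne_conjMap, VectorField.lieBracket, (hl' x).fderiv, (hl' y).fderiv,
    fderiv_chartMul_left]
  rfl

/-- The Lie bracket is the mixed derivative of conjugation, i.e. the differential of the adjoint
action. -/
theorem lie_eq_mixedOne_conjMap [CompleteSpace E] (x y : GroupLieAlgebra 𝓘(ℝ, E) G) :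
    ⁅x, y⁆ = mixedOne E E E (conjMap (G := G)) x y := by
  have : IsManifold 𝓘(ℝ, E) 1 G := IsManifold.of_le (n := ∞) (by exact_mod_cast le_top)
  rw [GroupLieAlgebra.bracket_def, ← VectorField.mlieBracketWithin_univ,
    VectorField.mlieBracketWithin_apply]
  have hi : ((mfderiv 𝓘(ℝ, E) 𝓘(ℝ, E) (chartOne E G) 1).inverse : E →L[ℝ] E) = .id ℝ E := by
    rw [mfderiv_extChartAt_self]
    exact ContinuousLinearMap.inverse_id
  have hu : (chartOne E G).symm ⁻¹' Set.univ ∩ Set.range 𝓘(ℝ, E) = Set.univ := by simp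
  refine (congrArg (fun D : E →L[ℝ] E => D _) hi).trans ?_
  rw [hu]
  refine Eq.trans ?_ (lieBracket_fderiv_chartMul (E := E) (G := G) x y)
  refine Eq.trans (congrFun (VectorField.lieBracketWithin_univ (E := E)) _) ?_
  exact Filter.EventuallyEq.lieBracket_vectorField_eq
    (eventually_mpullbackWithin_mulInvariantVectorField (E := E) (G := G) x)
    (eventually_mpullbackWithin_mulInvariantVectorField (E := E) (G := G) y)

end LieGroup

section Mixed

variable {E F K V E' F' K' G H L M G' H' L' : Type*}
  [NormedAddCommGroup E] [NormedSpace ℝ E] [NormedAddCommGroup F] [NormedSpace ℝ F]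
  [NormedAddCommGroup K] [NormedSpace ℝ K] [NormedAddCommGroup V] [NormedSpace ℝ V]
  [NormedAddCommGroup E'] [NormedSpace ℝ E'] [NormedAddCommGroup F'] [NormedSpace ℝ F']
  [NormedAddCommGroup K'] [NormedSpace ℝ K']
  [TopologicalSpace G] [ChartedSpace E G] [Group G] [LieGroup 𝓘(ℝ, E) ∞ G]
  [TopologicalSpace H] [ChartedSpace F H] [Group H] [LieGroup 𝓘(ℝ, F) ∞ H]
  [TopologicalSpace L] [ChartedSpace K L] [Group L] [LieGroup 𝓘(ℝ, K) ∞ L]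
  [TopologicalSpace M] [ChartedSpace V M] [Group M] [LieGroup 𝓘(ℝ, V) ∞ M]
  [TopologicalSpace G'] [ChartedSpace E' G'] [Group G'] [LieGroup 𝓘(ℝ, E') ∞ G']
  [TopologicalSpace H'] [ChartedSpace F' H'] [Group H'] [LieGroup 𝓘(ℝ, F') ∞ H']
  [TopologicalSpace L'] [ChartedSpace K' L'] [Group L'] [LieGroup 𝓘(ℝ, K') ∞ L']

/-! ### Rules of calculus for mixed derivatives -/

omit [LieGroup 𝓘(ℝ, E) ∞ G] in
theorem HasDerivOne.clm_apply {P : G → E' →L[ℝ] F'} {Q : G → E'} {P' : E →L[ℝ] E' →L[ℝ] F'}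
    {Q' : E →L[ℝ] E'} (hP : HasDerivOne E P P') (hQ : HasDerivOne E Q Q') :
    HasDerivOne E (fun g => P g (Q g)) (P 1 ∘L Q' + P'.flip (Q 1)) := by
  have := HasFDerivAt.clm_apply hP hQ
  simp only [chartOne_symm_coordOne] at this
  exact this

omit [LieGroup 𝓘(ℝ, E) ∞ G] in
theorem HasDerivOne.const_apply (T : E' →L[ℝ] F') {Q : G → E'}
    {Q' : E →L[ℝ] E'} (hQ : HasDerivOne E Q Q') : HasDerivOne E (fun g => T (Q g)) (T ∘L Q') :=
  T.hasFDerivAt.comp (coordOne E G) hQ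

omit [LieGroup 𝓘(ℝ, E) ∞ G] in
theorem HasDerivOne.apply_const {P : G → E' →L[ℝ] F'} {P' : E →L[ℝ] E' →L[ℝ] F'}
    (hP : HasDerivOne E P P') (v : E') : HasDerivOne E (fun g => P g v) (P'.flip v) :=
  (ContinuousLinearMap.hasFDerivAt (ContinuousLinearMap.apply ℝ F' v)).comp (coordOne E G) hP

omit [LieGroup 𝓘(ℝ, E) ∞ G] in
theorem HasDerivOne.add {P Q : G → F'} {P' Q' : E →L[ℝ] F'}
    (hP : HasDerivOne E P P') (hQ : HasDerivOne E Q Q') :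
    HasDerivOne E (fun g => P g + Q g) (P' + Q') :=
  HasFDerivAt.add hP hQ

omit [LieGroup 𝓘(ℝ, E) ∞ G] in
theorem HasDerivOne.unique {P : G → F'} {P' Q' : E →L[ℝ] F'}
    (hP : HasDerivOne E P P') (hQ : HasDerivOne E P Q') : P' = Q' :=
  HasFDerivAt.unique hP hQ

theorem PointedSmooth₂.hasDerivOne_apply {Ψ : G → H → L} (hΨ : PointedSmooth₂ E F K Ψ) (u : F) :
    HasDerivOne E (fun g => dOne F K (Ψ g) u) ((mixedOne E F K Ψ).flip u) :=
  hΨ.hasDerivOne.apply_const u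

omit [Group G] [LieGroup 𝓘(ℝ, E) ∞ G] [LieGroup 𝓘(ℝ, F) ∞ H] in
theorem PointedSmooth₂.mul {Ψ Ψ' : G → H → L} (hΨ : PointedSmooth₂ E F K Ψ)
    (hΨ' : PointedSmooth₂ E F K Ψ') : PointedSmooth₂ E F K (fun g h => Ψ g h * Ψ' g h) :=
  ⟨hΨ.contMDiff.mul hΨ'.contMDiff, fun g => by rw [hΨ.map_one, hΨ'.map_one, one_mul]⟩

theorem mixedOne_mul {Ψ Ψ' : G → H → L} (hΨ : PointedSmooth₂ E F K Ψ)
    (hΨ' : PointedSmooth₂ E F K Ψ') (x : E) (u : F) :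
    mixedOne E F K (fun g h => Ψ g h * Ψ' g h) x u =
      mixedOne E F K Ψ x u + mixedOne E F K Ψ' x u := by
  have h1 := (hΨ.mul hΨ').hasDerivOne
  simp_rw [fun g => dOne_mul (hΨ.pointedSmooth g) (hΨ'.pointedSmooth g)] at h1
  rw [h1.unique (hΨ.hasDerivOne.add hΨ'.hasDerivOne)]
  rfl

omit [Group G] [LieGroup 𝓘(ℝ, E) ∞ G] [LieGroup 𝓘(ℝ, F) ∞ H] [LieGroup 𝓘(ℝ, K) ∞ L] in
omit [LieGroup 𝓘(ℝ, K') ∞ L'] in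
theorem PointedSmooth.comp_pointedSmooth₂ {Ψ : G → H → L} (hΨ : PointedSmooth₂ E F K Ψ)
    {f : L → L'} (hf : PointedSmooth K K' f) : PointedSmooth₂ E F K' (fun g h => f (Ψ g h)) :=
  ⟨hf.contMDiff.comp hΨ.contMDiff, fun g => by rw [hΨ.map_one, hf.map_one]⟩

theorem mixedOne_left_comp {Ψ : G → H → L} (hΨ : PointedSmooth₂ E F K Ψ)
    {f : L → L'} (hf : PointedSmooth K K' f) (x : E) (u : F) :
    mixedOne E F K' (fun g h => f (Ψ g h)) x u = dOne K K' f (mixedOne E F K Ψ x u) := by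
  have h1 := (hf.comp_pointedSmooth₂ hΨ).hasDerivOne_apply u
  simp_rw [fun g => dOne_comp hf (hΨ.pointedSmooth g)] at h1
  exact congrArg (fun D : E →L[ℝ] K' => D x)
    (h1.unique ((hΨ.hasDerivOne_apply u).const_apply (dOne K K' f)))

omit [LieGroup 𝓘(ℝ, E) ∞ G] [LieGroup 𝓘(ℝ, F) ∞ H] [LieGroup 𝓘(ℝ, K) ∞ L] in
omit [LieGroup 𝓘(ℝ, E') ∞ G'] [LieGroup 𝓘(ℝ, F') ∞ H'] in
theorem PointedSmooth₂.comp {Ψ : G → H → L} (hΨ : PointedSmooth₂ E F K Ψ)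
    {p : G' → G} (hp : PointedSmooth E' E p) {q : H' → H} (hq : PointedSmooth F' F q) :
    PointedSmooth₂ E' F' K (fun g h => Ψ (p g) (q h)) :=
  ⟨hΨ.contMDiff.comp ((hp.contMDiff.comp contMDiff_fst).prodMk (hq.contMDiff.comp contMDiff_snd)),
    fun g => by rw [hq.map_one, hΨ.map_one]⟩

theorem mixedOne_comp {Ψ : G → H → L} (hΨ : PointedSmooth₂ E F K Ψ)
    {p : G' → G} (hp : PointedSmooth E' E p) {q : H' → H} (hq : PointedSmooth F' F q)
    (x : E') (u : F') :
    mixedOne E' F' K (fun g h => Ψ (p g) (q h)) x u =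
      mixedOne E F K Ψ (dOne E' E p x) (dOne F' F q u) := by
  have h1 := (hΨ.comp hp hq).hasDerivOne_apply u
  simp_rw [fun g => dOne_comp (hΨ.pointedSmooth (p g)) hq] at h1
  exact congrArg (fun D : E' →L[ℝ] K => D x)
    (h1.unique ((hΨ.hasDerivOne_apply (dOne F' F q u)).comp hp))

theorem mixedOne_comp_left {Ψ : G → H → L} (hΨ : PointedSmooth₂ E F K Ψ)
    {p : G' → G} (hp : PointedSmooth E' E p) (x : E') (u : F) :
    mixedOne E' F K (fun g h => Ψ (p g) h) x u = mixedOne E F K Ψ (dOne E' E p x) u := by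
  rw [mixedOne_comp hΨ hp pointedSmooth_id, dOne_id]
  rfl

theorem mixedOne_comp_right {Ψ : G → H → L} (hΨ : PointedSmooth₂ E F K Ψ)
    {q : H' → H} (hq : PointedSmooth F' F q) (x : E) (u : F') :
    mixedOne E F' K (fun g h => Ψ g (q h)) x u = mixedOne E F K Ψ x (dOne F' F q u) := by
  rw [mixedOne_comp hΨ pointedSmooth_id hq, dOne_id]
  rfl

variable (E F K G H L) in
omit [LieGroup 𝓘(ℝ, E) ∞ G] [LieGroup 𝓘(ℝ, F) ∞ H] [LieGroup 𝓘(ℝ, K) ∞ L] in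
/-- The family `(g, h) ↦ f h` does not depend on `g`. -/
theorem mixedOne_const (f : H → L) : mixedOne E F K (fun (_ : G) h => f h) = 0 := by
  simp [mixedOne]

omit [Group G] [LieGroup 𝓘(ℝ, E) ∞ G] [LieGroup 𝓘(ℝ, F) ∞ H] [LieGroup 𝓘(ℝ, K) ∞ L] in
omit [LieGroup 𝓘(ℝ, F') ∞ H'] in
theorem PointedSmooth₂.comp₂ {Ψ : G → H → L} (hΨ : PointedSmooth₂ E F K Ψ)
    {Θ : G → H' → H} (hΘ : PointedSmooth₂ E F' F Θ) :
    PointedSmooth₂ E F' K (fun g h => Ψ g (Θ g h)) :=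
  ⟨hΨ.contMDiff.comp (contMDiff_fst.prodMk hΘ.contMDiff),
    fun g => by rw [hΘ.map_one, hΨ.map_one]⟩

theorem mixedOne_comp₂ {Ψ : G → H → L} (hΨ : PointedSmooth₂ E F K Ψ)
    {Θ : G → H' → H} (hΘ : PointedSmooth₂ E F' F Θ) (x : E) (u : F') :
    mixedOne E F' K (fun g h => Ψ g (Θ g h)) x u =
      dOne F K (Ψ 1) (mixedOne E F' F Θ x u) + mixedOne E F K Ψ x (dOne F' F (Θ 1) u) := by
  have h1 := (hΨ.comp₂ hΘ).hasDerivOne_apply u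
  simp_rw [fun g => dOne_comp (hΨ.pointedSmooth g) (hΘ.pointedSmooth g)] at h1
  exact congrArg (fun D : E →L[ℝ] K => D x)
    (h1.unique (hΨ.hasDerivOne.clm_apply (hΘ.hasDerivOne_apply u)))

/-- If `Ψ` is equivariant under the actions `σ`, `τ`, `υ` of `M`, then its mixed derivative is
equivariant under the infinitesimal actions: the equivariance relation is differentiated in `h`,
then in `g`, and finally in `m`. -/
theorem mixedOne_equivariant {Ψ : G → H → L} (hΨ : PointedSmooth₂ E F K Ψ)
    {σ : M → G → G} (hσ : PointedSmooth₂ V E E σ) (hσ1 : ∀ g, σ 1 g = g)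
    {τ : M → H → H} (hτ : PointedSmooth₂ V F F τ) (hτ1 : ∀ h, τ 1 h = h)
    {υ : M → L → L} (hυ : PointedSmooth₂ V K K υ)
    (heq : ∀ m g h, Ψ (σ m g) (τ m h) = υ m (Ψ g h)) (w : V) (x : E) (u : F) :
    mixedOne E F K Ψ (mixedOne V E E σ w x) u + mixedOne E F K Ψ x (mixedOne V F F τ w u) =
      mixedOne V K K υ w (mixedOne E F K Ψ x u) := by
  have key : ∀ m, mixedOne E F K Ψ (dOne E E (σ m) x) (dOne F F (τ m) u) =
      dOne K K (υ m) (mixedOne E F K Ψ x u) := fun m => by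
    rw [← mixedOne_comp hΨ (hσ.pointedSmooth m) (hτ.pointedSmooth m),
      ← mixedOne_left_comp hΨ (hυ.pointedSmooth m)]
    simp_rw [heq]
  have h1 := HasDerivOne.clm_apply ((hσ.hasDerivOne_apply x).const_apply (mixedOne E F K Ψ))
    (hτ.hasDerivOne_apply u)
  simp_rw [key] at h1
  have h2 := congrArg (fun D : V →L[ℝ] K => D w)
    (h1.unique (hυ.hasDerivOne_apply (mixedOne E F K Ψ x u)))
  have e1 : dOne E E (σ 1) = .id ℝ E := by rw [funext hσ1, dOne_id]
  have e2 : dOne F F (τ 1) = .id ℝ F := by rw [funext hτ1, dOne_id]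
  simp only [e1, e2] at h2
  rw [add_comm]
  exact h2

/-! ### Actions by automorphisms, crossed homomorphisms and Rota-Baxter operators -/

/-- The infinitesimal action acts by derivations. -/
theorem mixedOne_derivation {φ : G →* MulAut H}
    (hφ : PointedSmooth₂ E F F (fun g h => φ g h)) (x : E) (u v : F) :
    mixedOne E F F (fun g h => φ g h) x (mixedOne F F F (conjMap (G := H)) u v) =
      mixedOne F F F (conjMap (G := H)) (mixedOne E F F (fun g h => φ g h) x u) v +
      mixedOne F F F (conjMap (G := H)) u (mixedOne E F F (fun g h => φ g h) x v) :=
  (mixedOne_equivariant pointedSmooth₂_conjMap hφ (by simp) hφ (by simp) hφ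
    (fun m g h => by simp [conjMap]) x u v).symm

/-- The infinitesimal action is compatible with brackets. -/
theorem mixedOne_lie {φ : G →* MulAut H}
    (hφ : PointedSmooth₂ E F F (fun g h => φ g h)) (x y : E) (u : F) :
    mixedOne E F F (fun g h => φ g h) (mixedOne E E E (conjMap (G := G)) x y) u =
      mixedOne E F F (fun g h => φ g h) x (mixedOne E F F (fun g h => φ g h) y u) -
      mixedOne E F F (fun g h => φ g h) y (mixedOne E F F (fun g h => φ g h) x u) :=
  eq_sub_of_add_eq (mixedOne_equivariant hφ pointedSmooth₂_conjMap (by simp [conjMap]) hφ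
    (by simp) hφ (fun m g h => by simp [conjMap]) x y u)

/-- The mixed derivative of a family `γ · l : G → H` of crossed homomorphisms is a family of crossed
homomorphisms of Lie algebras. The cocycle relation is applied to `(g k g⁻¹) g = g k`, first
differentiated in `l`, then in `k`, and finally in `g`. -/
theorem mixedOne_crossedHom {φ : G →* MulAut H}
    (hφ : PointedSmooth₂ E F F (fun g h => φ g h)) {γ : G → L → H}
    (hγ : PointedSmooth₂ E K F γ) (hmul : ∀ g g' l, γ (g * g') l = γ g l * φ g (γ g' l))
    (x y : E) (w : K) :
    mixedOne E K F γ (mixedOne E E E (conjMap (G := G)) x y) w =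
      mixedOne E F F (fun g h => φ g h) x (mixedOne E K F γ y w) -
      mixedOne E F F (fun g h => φ g h) y (mixedOne E K F γ x w) := by
  have hc := pointedSmooth₂_conjMap (E := E) (G := G)
  have h1 : ∀ l, γ 1 l = 1 := fun l => by simpa using hmul 1 1 l
  have d1 : dOne K F (γ 1) = 0 := by rw [funext h1, dOne_const_one]
  have hd : ∀ g g', dOne K F (γ (g * g')) =
      dOne K F (γ g) + dOne F F (φ g) ∘L dOne K F (γ g') := fun g g' => by
    rw [← dOne_comp (hφ.pointedSmooth g) (hγ.pointedSmooth g'),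
      ← dOne_mul (hγ.pointedSmooth g) ((hφ.pointedSmooth g).comp (hγ.pointedSmooth g'))]
    exact congrArg _ (funext (hmul g g'))
  have key : ∀ g, mixedOne E K F γ (dOne E E (conjMap g) y) w +
      mixedOne E F F (fun g h => φ g h) (dOne E E (conjMap g) y) (dOne K F (γ g) w) =
      dOne F F (φ g) (mixedOne E K F γ y w) := fun g => by
    have e : ∀ k, dOne K F (γ (conjMap g k)) w + dOne F F (φ (conjMap g k)) (dOne K F (γ g) w) =
        dOne K F (γ g) w + dOne F F (φ g) (dOne K F (γ k) w) := fun k => by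
      have : conjMap g k * g = g * k := by simp [conjMap]
      have h2 := hd (conjMap g k) g
      rw [this, hd] at h2
      exact (congrArg (fun D : K →L[ℝ] F => D w) h2).symm
    have hl := (((hγ.hasDerivOne_apply w).comp (hc.pointedSmooth g)).add
      ((hφ.hasDerivOne_apply (dOne K F (γ g) w)).comp (hc.pointedSmooth g)))
    have hr := ((hγ.hasDerivOne_apply w).const_apply (dOne F F (φ g)))
    have hr' : HasDerivOne E (fun k => dOne K F (γ g) w + dOne F F (φ g) (dOne K F (γ k) w)) _ :=
      HasFDerivAt.const_add (dOne K F (γ g) w) hr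
    simp_rw [e] at hl
    exact congrArg (fun D : E →L[ℝ] F => D y) (hl.unique hr')
  have hl := ((hc.hasDerivOne_apply y).const_apply ((mixedOne E K F γ).flip w)).add
    (HasDerivOne.clm_apply ((hc.hasDerivOne_apply y).const_apply
      (mixedOne E F F (fun g h => φ g h))) (hγ.hasDerivOne_apply w))
  have hr := hφ.hasDerivOne_apply (mixedOne E K F γ y w)
  simp only [ContinuousLinearMap.flip_apply, key] at hl
  have h2 := congrArg (fun D : E →L[ℝ] F => D x) (hl.unique hr)
  have e1 : dOne E E (conjMap (1 : G)) = .id ℝ E := by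
    rw [← dOne_id (G := G)]; congr 1; ext; simp [conjMap]
  rw [eq_sub_iff_add_eq]
  simpa [d1, e1] using h2

/-- The differential of a relative Rota-Baxter operator on Lie groups satisfies the relative
Rota-Baxter identity of weight `1`. -/
theorem mixedOne_rotaBaxter {φ : G →* MulAut H}
    (hφ : PointedSmooth₂ E F F (fun g h => φ g h)) {B : H → G} (hB : PointedSmooth F E B)
    (hmul : ∀ h h', B h * B h' = B (h * φ (B h) h')) (u v : F) :
    mixedOne E E E (conjMap (G := G)) (dOne F E B u) (dOne F E B v) =
      dOne F E B (mixedOne E F F (fun g h => φ g h) (dOne F E B u) v -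
        mixedOne E F F (fun g h => φ g h) (dOne F E B v) u +
        mixedOne F F F (conjMap (G := H)) u v) := by
  have hcG := pointedSmooth₂_conjMap (E := E) (G := G)
  have hcH := pointedSmooth₂_conjMap (E := F) (G := H)
  -- `Q h g = h · φ g h⁻¹`, whose mixed derivative is computed by exchanging the two arguments
  have hQ : PointedSmooth₂ F E F (fun (h : H) (g : G) => h * φ g h⁻¹) :=
    ⟨contMDiff_fst.mul (hφ.contMDiff.comp (contMDiff_snd.prodMk contMDiff_fst.inv)), by simp⟩
  have hpr : PointedSmooth₂ E F F (fun (_ : G) (h : H) => h) := ⟨contMDiff_snd, fun _ => rfl⟩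
  have hQm : ∀ u x, mixedOne F E F (fun (h : H) (g : G) => h * φ g h⁻¹) u x =
      -mixedOne E F F (fun g h => φ g h) x u := fun u x => by
    rw [hQ.mixedOne_flip, mixedOne_mul hpr (hφ.comp pointedSmooth_id pointedSmooth_inv),
      mixedOne_comp_right hφ pointedSmooth_inv, dOne_inv, mixedOne_const E F F G H H (fun h => h)]
    simp
  have h1 : PointedSmooth₂ F F F (fun h k : H => φ (B h) k) :=
    hφ.comp hB pointedSmooth_id
  have h2 : PointedSmooth₂ F F E (fun h k : H => conjMap (B h) (B k)) := hcG.comp hB hB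
  -- the inverse of `h` for the product `h · φ (B h) h'`, for which `B` is a homomorphism, is
  -- `(φ (B h))⁻¹ h⁻¹`; the argument of `B` below is the conjugate of `k` by `h` for this product
  have hinv : ∀ h, B ((φ (B h))⁻¹ h⁻¹) = (B h)⁻¹ := fun h =>
    eq_inv_of_mul_eq_one_right (by rw [hmul, MulAut.apply_inv_self, mul_inv_cancel, hB.map_one])
  have hC : (fun h k => B (conjMap h (φ (B h) k) * (h * φ (conjMap (B h) (B k)) h⁻¹))) =
      fun h k => conjMap (B h) (B k) := by
    funext h k
    symm
    calc conjMap (B h) (B k) = B h * B k * B ((φ (B h))⁻¹ h⁻¹) := by rw [hinv]; rfl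
      _ = B (h * φ (B h) k * φ (B h * B k) ((φ (B h))⁻¹ h⁻¹)) := by rw [hmul h k, hmul]
      _ = _ := by simp [conjMap, mul_assoc]
  have hm := mixedOne_comp hcG hB hB u v
  rw [← hC, mixedOne_left_comp ((hcH.comp₂ h1).mul (hQ.comp₂ h2)) hB,
    mixedOne_mul (hcH.comp₂ h1) (hQ.comp₂ h2), mixedOne_comp₂ hcH h1, mixedOne_comp₂ hQ h2,
    mixedOne_comp_left hφ hB, hQm] at hm
  have e1 : dOne F F (conjMap (1 : H)) = .id ℝ F := by
    rw [← dOne_id (G := H)]; congr 1; ext; simp [conjMap]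
  have e2 : dOne F F (fun k : H => φ (B 1) k) = .id ℝ F := by
    rw [← dOne_id (G := H)]; congr 1; ext; simp [hB.map_one]
  have e3 : dOne E F (fun g : G => (1 : H) * φ g 1⁻¹) = 0 := by simp [dOne_const_one]
  have e4 : dOne F E (fun k : H => conjMap (B 1) (B k)) = dOne F E B := by
    congr 1; ext; simp [conjMap, hB.map_one]
  rw [← hm, e1, e2, e3, e4]
  congr 1
  simp only [ContinuousLinearMap.id_apply, zero_apply]
  abel

end Mixed

/-! ### Differentiation of homomorphisms and actions -/

section LieFunctor

variable {E F G H : Type*}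
  [NormedAddCommGroup E] [NormedSpace ℝ E] [CompleteSpace E]
  [NormedAddCommGroup F] [NormedSpace ℝ F] [CompleteSpace F]
  [TopologicalSpace G] [ChartedSpace E G] [Group G] [LieGroup 𝓘(ℝ, E) ∞ G]
  [TopologicalSpace H] [ChartedSpace F H] [Group H] [LieGroup 𝓘(ℝ, F) ∞ H]

omit [CompleteSpace E] [CompleteSpace F] in
theorem mixedOne_conjMap_map {f : G →* H} (hf : PointedSmooth E F f) (x y : E) :
    dOne E F f (mixedOne E E E (conjMap (G := G)) x y) =
      mixedOne F F F (conjMap (G := H)) (dOne E F f x) (dOne E F f y) := by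
  rw [← mixedOne_left_comp pointedSmooth₂_conjMap hf, ← mixedOne_comp pointedSmooth₂_conjMap hf hf]
  simp [conjMap]

/-- The differential of a smooth group homomorphism, as a Lie algebra homomorphism. -/
def lieHomOfMonoidHom (f : G →* H) (hf : ContMDiff 𝓘(ℝ, E) 𝓘(ℝ, F) ∞ f) :
    GroupLieAlgebra 𝓘(ℝ, E) G →ₗ⁅ℝ⁆ GroupLieAlgebra 𝓘(ℝ, F) H where
  toFun x := dOne E F f x
  map_add' x y := (dOne E F f).map_add x y
  map_smul' c x := (dOne E F f).map_smul c x
  map_lie' {x y} := by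
    exact (congrArg (fun z : E => dOne E F f z) (lie_eq_mixedOne_conjMap x y)).trans
      ((mixedOne_conjMap_map (E := E) (F := F) ⟨hf, map_one f⟩ x y).trans
        (lie_eq_mixedOne_conjMap (E := F) (G := H) (dOne E F f x) (dOne E F f y)).symm)

/-- The infinitesimal action of a smooth action of a Lie group by automorphisms of another one, as
a Lie algebra homomorphism to the derivations. -/
def lieHomOfAction (φ : G →* MulAut H) (hφ : PointedSmooth₂ E F F (fun g h => φ g h)) :
    GroupLieAlgebra 𝓘(ℝ, E) G →ₗ⁅ℝ⁆
      LieDerivation ℝ (GroupLieAlgebra 𝓘(ℝ, F) H) (GroupLieAlgebra 𝓘(ℝ, F) H) where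
  toFun x :=
    { toFun := fun u => mixedOne E F F (fun g h => φ g h) x u
      map_add' := fun u v => (mixedOne E F F (fun g h => φ g h) x).map_add u v
      map_smul' := fun c u => (mixedOne E F F (fun g h => φ g h) x).map_smul c u
      leibniz' := fun u v => by
        rw [← lie_skew v, sub_neg_eq_add, add_comm]
        simp only [lie_eq_mixedOne_conjMap]
        exact mixedOne_derivation hφ x u v }
  map_add' x y := by
    ext u
    exact congrArg (fun D : F →L[ℝ] F => D u) ((mixedOne E F F (fun g h => φ g h)).map_add x y)
  map_smul' c x := by
    ext u
    exact congrArg (fun D : F →L[ℝ] F => D u) ((mixedOne E F F (fun g h => φ g h)).map_smul c x)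
  map_lie' {x y} := by
    ext u
    rw [LieDerivation.commutator_apply, lie_eq_mixedOne_conjMap]
    exact mixedOne_lie hφ x y u

omit [CompleteSpace E] [CompleteSpace F] in
theorem diffOne_eq_toLinearMap {f : G → H} (hf : PointedSmooth E F f) :
    diffOne E F f = ContinuousLinearMap.toLinearMap (M := E) (M₂ := F) (dOne E F f) :=
  LinearMap.ext fun x => diffOne_eq_dOne (E := E) (F := F) hf x

omit [CompleteSpace E] [CompleteSpace F] [LieGroup 𝓘(ℝ, E) ∞ G] [LieGroup 𝓘(ℝ, F) ∞ H] in
theorem IsRelativeRotaBaxter.pointedSmooth {φ : G →* MulAut H} {B : H → G}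
    (hB : IsRelativeRotaBaxter E F φ B) : PointedSmooth F E B :=
  ⟨hB.contMDiff, by simpa using hB.mul_eq 1 1⟩

end LieFunctor

namespace LieGroupCrossedModule

/-! ### The structure maps of a crossed module and of an action -/

section StructureMaps

variable {E₁ E₀ F₁ F₀ G₁ G₀ H₁ H₀ : Type*}
  [NormedAddCommGroup E₁] [NormedSpace ℝ E₁] [NormedAddCommGroup E₀] [NormedSpace ℝ E₀]
  [NormedAddCommGroup F₁] [NormedSpace ℝ F₁] [NormedAddCommGroup F₀] [NormedSpace ℝ F₀]
  [TopologicalSpace G₁] [ChartedSpace E₁ G₁] [Group G₁] [LieGroup 𝓘(ℝ, E₁) ∞ G₁]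
  [TopologicalSpace G₀] [ChartedSpace E₀ G₀] [Group G₀] [LieGroup 𝓘(ℝ, E₀) ∞ G₀]
  [TopologicalSpace H₁] [ChartedSpace F₁ H₁] [Group H₁] [LieGroup 𝓘(ℝ, F₁) ∞ H₁]
  [TopologicalSpace H₀] [ChartedSpace F₀ H₀] [Group H₀] [LieGroup 𝓘(ℝ, F₀) ∞ H₀]
  (G : LieGroupCrossedModule E₁ E₀ G₁ G₀) {H : LieGroupCrossedModule F₁ F₀ H₁ H₀}
  (Φ : G.Action H)

theorem pointedSmooth_bd : PointedSmooth E₁ E₀ G.bd := ⟨G.contMDiff_bd, map_one _⟩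

theorem pointedSmooth₂_act : PointedSmooth₂ E₀ E₁ E₁ (fun g h => G.act g h) :=
  ⟨G.contMDiff_act, fun _ => map_one _⟩

variable {G}

theorem Der.apply_one (γ : H.Der) : γ 1 = 1 := by simpa using γ.map_mul 1 1

theorem Action.alpha_one (h : H₀) : (Φ.alpha 1 : H.Der) h = 1 := by
  rw [map_one]; rfl

theorem Action.pointedSmooth₂_alpha :
    PointedSmooth₂ E₁ F₀ F₁ (fun g h => (Φ.alpha g : H.Der) h) :=
  ⟨Φ.contMDiff_alpha, fun _ => Der.apply_one _⟩

theorem Action.pointedSmooth₂_beta₁ : PointedSmooth₂ E₀ F₁ F₁ (fun g h => Φ.beta₁ g h) :=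
  ⟨Φ.contMDiff_beta₁, fun _ => map_one _⟩

theorem Action.pointedSmooth₂_beta₀ : PointedSmooth₂ E₀ F₀ F₀ (fun g h => Φ.beta₀ g h) :=
  ⟨Φ.contMDiff_beta₀, fun _ => map_one _⟩

theorem Action.pointedSmooth₂_alpha_flip :
    PointedSmooth₂ F₀ E₁ F₁ (fun h g => (Φ.alpha g : H.Der) h) :=
  ⟨Φ.contMDiff_alpha.comp (contMDiff_snd.prodMk contMDiff_fst), Φ.alpha_one⟩

theorem Action.bd_beta₁ (g : G₀) (h : H₁) : H.bd (Φ.beta₁ g h) = Φ.beta₀ g (H.bd h) :=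
  (Φ.beta g).2.2.2.1 h

theorem Action.beta₁_act (g : G₀) (h₀ : H₀) (h₁ : H₁) :
    Φ.beta₁ g (H.act h₀ h₁) = H.act (Φ.beta₀ g h₀) (Φ.beta₁ g h₁) :=
  (Φ.beta g).2.2.2.2 h₀ h₁

theorem Action.alpha_act_beta₀ (g₀ : G₀) (g : G₁) (h : H₀) :
    (Φ.alpha (G.act g₀ g) : H.Der) (Φ.beta₀ g₀ h) = Φ.beta₁ g₀ ((Φ.alpha g : H.Der) h) := by
  rw [Φ.alpha_act]
  exact congrArg (fun k => Φ.beta₁ g₀ ((Φ.alpha g : H.Der) k))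
    ((Φ.beta₀ g₀).symm_apply_apply h)

/-! ### Identities between the mixed derivatives of the structure maps -/

theorem mixedOne_act_bd (ξ η : E₁) :
    mixedOne E₀ E₁ E₁ (fun g h => G.act g h) (dOne E₁ E₀ G.bd ξ) η =
      mixedOne E₁ E₁ E₁ (conjMap (G := G₁)) ξ η := by
  rw [← mixedOne_comp_left G.pointedSmooth₂_act G.pointedSmooth_bd]
  simp only [G.act_bd]
  rfl

theorem mixedOne_bd_act (x : E₀) (ξ : E₁) :
    dOne E₁ E₀ G.bd (mixedOne E₀ E₁ E₁ (fun g h => G.act g h) x ξ) =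
      mixedOne E₀ E₀ E₀ (conjMap (G := G₀)) x (dOne E₁ E₀ G.bd ξ) := by
  rw [← mixedOne_left_comp G.pointedSmooth₂_act G.pointedSmooth_bd,
    ← mixedOne_comp_right pointedSmooth₂_conjMap G.pointedSmooth_bd]
  simp only [G.bd_act]
  rfl

namespace Action

theorem mixedOne_bd_beta₁ (x : E₀) (a : F₁) :
    dOne F₁ F₀ H.bd (mixedOne E₀ F₁ F₁ (fun g h => Φ.beta₁ g h) x a) =
      mixedOne E₀ F₀ F₀ (fun g h => Φ.beta₀ g h) x (dOne F₁ F₀ H.bd a) := by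
  rw [← mixedOne_left_comp Φ.pointedSmooth₂_beta₁ H.pointedSmooth_bd,
    ← mixedOne_comp_right Φ.pointedSmooth₂_beta₀ H.pointedSmooth_bd]
  simp only [Φ.bd_beta₁]

theorem mixedOne_beta₁_bd (ξ : E₁) (a : F₁) :
    mixedOne E₁ F₀ F₁ (fun g h => (Φ.alpha g : H.Der) h) ξ (dOne F₁ F₀ H.bd a) =
      mixedOne E₀ F₁ F₁ (fun g h => Φ.beta₁ g h) (dOne E₁ E₀ G.bd ξ) a := by
  have h : (fun g h => (Φ.alpha g : H.Der) (H.bd h) * h) = fun g h => Φ.beta₁ (G.bd g) h :=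
    funext₂ Φ.beta₁_bd
  rw [← mixedOne_comp_left Φ.pointedSmooth₂_beta₁ G.pointedSmooth_bd, ← h,
    mixedOne_mul (Φ.pointedSmooth₂_alpha.comp pointedSmooth_id H.pointedSmooth_bd)
      ⟨contMDiff_snd, fun _ => rfl⟩,
    mixedOne_comp_right Φ.pointedSmooth₂_alpha H.pointedSmooth_bd,
    mixedOne_const E₁ F₁ F₁ G₁ H₁ H₁ fun h => h]
  simp

theorem mixedOne_beta₀_bd (ξ : E₁) (u : F₀) :
    dOne F₁ F₀ H.bd (mixedOne E₁ F₀ F₁ (fun g h => (Φ.alpha g : H.Der) h) ξ u) =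
      mixedOne E₀ F₀ F₀ (fun g h => Φ.beta₀ g h) (dOne E₁ E₀ G.bd ξ) u := by
  have h : (fun g h => H.bd ((Φ.alpha g : H.Der) h) * h) = fun g h => Φ.beta₀ (G.bd g) h :=
    funext₂ Φ.beta₀_bd
  rw [← mixedOne_comp_left Φ.pointedSmooth₂_beta₀ G.pointedSmooth_bd, ← h,
    mixedOne_mul (H.pointedSmooth_bd.comp_pointedSmooth₂ Φ.pointedSmooth₂_alpha)
      ⟨contMDiff_snd, fun _ => rfl⟩,
    mixedOne_left_comp Φ.pointedSmooth₂_alpha H.pointedSmooth_bd,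
    mixedOne_const E₁ F₀ F₀ G₁ H₀ H₀ fun h => h]
  simp

theorem mixedOne_alpha_act (x : E₀) (ξ : E₁) (u : F₀) :
    mixedOne E₁ F₀ F₁ (fun g h => (Φ.alpha g : H.Der) h)
        (mixedOne E₀ E₁ E₁ (fun g h => G.act g h) x ξ) u =
      mixedOne E₀ F₁ F₁ (fun g h => Φ.beta₁ g h) x
          (mixedOne E₁ F₀ F₁ (fun g h => (Φ.alpha g : H.Der) h) ξ u) -
        mixedOne E₁ F₀ F₁ (fun g h => (Φ.alpha g : H.Der) h) ξ
          (mixedOne E₀ F₀ F₀ (fun g h => Φ.beta₀ g h) x u) :=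
  eq_sub_of_add_eq (mixedOne_equivariant Φ.pointedSmooth₂_alpha G.pointedSmooth₂_act (by simp)
    Φ.pointedSmooth₂_beta₀ (by simp) Φ.pointedSmooth₂_beta₁ Φ.alpha_act_beta₀ x ξ u)

/-- Since `[ξ, η] = bd ξ ▷ η` and `beta (bd ξ) = Δ (alpha ξ)`, this is a case of the equivariance of
`alpha`. -/
theorem mixedOne_alpha_lie (ξ η : E₁) (u : F₀) :
    mixedOne E₁ F₀ F₁ (fun g h => (Φ.alpha g : H.Der) h)
        (mixedOne E₁ E₁ E₁ (conjMap (G := G₁)) ξ η) u =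
      mixedOne E₁ F₀ F₁ (fun g h => (Φ.alpha g : H.Der) h) ξ
          (dOne F₁ F₀ H.bd (mixedOne E₁ F₀ F₁ (fun g h => (Φ.alpha g : H.Der) h) η u)) -
        mixedOne E₁ F₀ F₁ (fun g h => (Φ.alpha g : H.Der) h) η
          (dOne F₁ F₀ H.bd (mixedOne E₁ F₀ F₁ (fun g h => (Φ.alpha g : H.Der) h) ξ u)) := by
  rw [← G.mixedOne_act_bd, mixedOne_alpha_act, mixedOne_beta₁_bd, mixedOne_beta₀_bd]

/-- Exchanging the two arguments of `alpha` gives the family `h ↦ alpha g h` of crossed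
homomorphisms. -/
theorem mixedOne_alpha_leibniz (ξ : E₁) (u v : F₀) :
    mixedOne E₁ F₀ F₁ (fun g h => (Φ.alpha g : H.Der) h) ξ
        (mixedOne F₀ F₀ F₀ (conjMap (G := H₀)) u v) =
      mixedOne F₀ F₁ F₁ (fun g h => H.act g h) u
          (mixedOne E₁ F₀ F₁ (fun g h => (Φ.alpha g : H.Der) h) ξ v) -
        mixedOne F₀ F₁ F₁ (fun g h => H.act g h) v
          (mixedOne E₁ F₀ F₁ (fun g h => (Φ.alpha g : H.Der) h) ξ u) := by
  simp only [Φ.pointedSmooth₂_alpha.mixedOne_flip ξ]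
  exact mixedOne_crossedHom H.pointedSmooth₂_act Φ.pointedSmooth₂_alpha_flip
    (fun h h' g => (Φ.alpha g : H.Der).map_mul h h') u v ξ

/-- The infinitesimal form of the mixed Rota-Baxter identity. The sign of `alpha` comes from `h₀⁻¹`
in the group identity. -/
theorem IsRelativeRotaBaxter.mixedOne_mixed {Φ : G.Action H} {B₁ : H₁ → G₁} {B₀ : H₀ → G₀}
    (hB : Φ.IsRelativeRotaBaxter B₁ B₀) (hB₁ : PointedSmooth F₁ E₁ B₁)
    (hB₀ : PointedSmooth F₀ E₀ B₀) (u : F₀) (a : F₁) :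
    mixedOne E₀ E₁ E₁ (fun g h => G.act g h) (dOne F₀ E₀ B₀ u) (dOne F₁ E₁ B₁ a) =
      dOne F₁ E₁ B₁
        (mixedOne E₀ F₁ F₁ (fun g h => Φ.beta₁ g h) (dOne F₀ E₀ B₀ u) a -
          mixedOne E₁ F₀ F₁ (fun g h => (Φ.alpha g : H.Der) h) (dOne F₁ E₁ B₁ a) u +
          mixedOne F₀ F₁ F₁ (fun g h => H.act g h) u a) := by
  have hGB := G.pointedSmooth₂_act.comp hB₀ hB₁
  have hβ := Φ.pointedSmooth₂_beta₁.comp hB₀ (pointedSmooth_id (E := F₁) (G := H₁))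
  have hA := Φ.pointedSmooth₂_alpha_flip.comp (pointedSmooth_inv (E := F₀) (G := H₀))
    (pointedSmooth_id (E := E₁) (G := G₁))
  have hαA := hA.comp₂ hGB
  have e : (fun h₀ h₁ => G.act (B₀ h₀) (B₁ h₁)) = fun h₀ h₁ =>
      B₁ (H.act h₀ (Φ.beta₁ (B₀ h₀) h₁ *
        (Φ.alpha (G.act (B₀ h₀) (B₁ h₁)) : H.Der) h₀⁻¹)) := funext₂ hB.mixed
  rw [← mixedOne_comp G.pointedSmooth₂_act hB₀ hB₁, e,
    mixedOne_left_comp (H.pointedSmooth₂_act.comp₂ (hβ.mul hαA)) hB₁,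
    mixedOne_comp₂ H.pointedSmooth₂_act (hβ.mul hαA), mixedOne_mul hβ hαA,
    mixedOne_comp_left Φ.pointedSmooth₂_beta₁ hB₀, mixedOne_comp₂ hA hGB,
    mixedOne_comp_left Φ.pointedSmooth₂_alpha_flip pointedSmooth_inv, dOne_inv]
  have e1 : dOne F₁ F₁ (fun h => H.act 1 h) = .id ℝ F₁ := by
    rw [← dOne_id (G := H₁)]; congr 1; ext; simp
  have e2 : dOne F₁ F₁ (fun h₁ => Φ.beta₁ (B₀ 1) h₁ *
      (Φ.alpha (G.act (B₀ 1) (B₁ h₁)) : H.Der) 1⁻¹) = .id ℝ F₁ := by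
    rw [← dOne_id (G := H₁)]; congr 1; ext; simp [hB₀.map_one, Der.apply_one]
  have e3 : dOne E₁ F₁ (fun g => (Φ.alpha g : H.Der) 1⁻¹) = 0 := by
    simp [Der.apply_one, dOne_const_one]
  have e4 : dOne F₁ E₁ (fun h₁ => G.act (B₀ 1) (B₁ h₁)) = dOne F₁ E₁ B₁ := by
    congr 1; ext; simp [hB₀.map_one]
  rw [e1, e2, e3, e4, Φ.pointedSmooth₂_alpha.mixedOne_flip]
  congr 1
  simp [sub_eq_add_neg]

end Action

end StructureMaps

/-! ### The infinitesimal crossed module, action and Rota-Baxter operator -/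

variable {E₁ E₀ F₁ F₀ G₁ G₀ H₁ H₀ : Type*}
  [NormedAddCommGroup E₁] [NormedSpace ℝ E₁] [CompleteSpace E₁]
  [NormedAddCommGroup E₀] [NormedSpace ℝ E₀] [CompleteSpace E₀]
  [NormedAddCommGroup F₁] [NormedSpace ℝ F₁] [CompleteSpace F₁]
  [NormedAddCommGroup F₀] [NormedSpace ℝ F₀] [CompleteSpace F₀]
  [TopologicalSpace G₁] [ChartedSpace E₁ G₁] [Group G₁] [LieGroup 𝓘(ℝ, E₁) ∞ G₁]
  [TopologicalSpace G₀] [ChartedSpace E₀ G₀] [Group G₀] [LieGroup 𝓘(ℝ, E₀) ∞ G₀]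
  [TopologicalSpace H₁] [ChartedSpace F₁ H₁] [Group H₁] [LieGroup 𝓘(ℝ, F₁) ∞ H₁]
  [TopologicalSpace H₀] [ChartedSpace F₀ H₀] [Group H₀] [LieGroup 𝓘(ℝ, F₀) ∞ H₀]

/-- The Lie algebra crossed module of a Lie group crossed module. -/
def lieAlgebra (G : LieGroupCrossedModule E₁ E₀ G₁ G₀) :
    LieAlgebraCrossedModule ℝ (GroupLieAlgebra 𝓘(ℝ, E₁) G₁) (GroupLieAlgebra 𝓘(ℝ, E₀) G₀) where
  bd := lieHomOfMonoidHom G.bd G.contMDiff_bd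
  act := lieHomOfAction G.act G.pointedSmooth₂_act
  act_bd a b := by
    rw [lie_eq_mixedOne_conjMap]
    exact mixedOne_act_bd (E₁ := E₁) (E₀ := E₀) a b
  bd_act u a := by
    exact (mixedOne_bd_act (E₁ := E₁) (E₀ := E₀) u a).trans
      (lie_eq_mixedOne_conjMap (E := E₀) (G := G₀) u (dOne E₁ E₀ G.bd a)).symm

theorem isInfinitesimal_lieAlgebra (G : LieGroupCrossedModule E₁ E₀ G₁ G₀) :
    G.IsInfinitesimal G.lieAlgebra where
  bd_eq ξ := (diffOne_eq_dOne G.pointedSmooth_bd ξ).symm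
  act_eq x ξ := (mixedDiffOne_eq_mixedOne G.pointedSmooth₂_act x ξ).symm

variable {G : LieGroupCrossedModule E₁ E₀ G₁ G₀} {H : LieGroupCrossedModule F₁ F₀ H₁ H₀}

/-- The infinitesimal action of an action of Lie group crossed modules. -/
def Action.lieAlgebra (Φ : G.Action H) : G.lieAlgebra.Action H.lieAlgebra where
  alpha :=
    { toFun := fun ξ =>
        { toFun := fun u => mixedOne E₁ F₀ F₁ (fun g h => (Φ.alpha g : H.Der) h) ξ u
          map_add' := fun u v =>
            (mixedOne E₁ F₀ F₁ (fun g h => (Φ.alpha g : H.Der) h) ξ).map_add u v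
          map_smul' := fun c u =>
            (mixedOne E₁ F₀ F₁ (fun g h => (Φ.alpha g : H.Der) h) ξ).map_smul c u }
      map_add' := fun ξ η => by
        ext u
        exact congrArg (fun D : F₀ →L[ℝ] F₁ => D u)
          ((mixedOne E₁ F₀ F₁ (fun g h => (Φ.alpha g : H.Der) h)).map_add ξ η)
      map_smul' := fun c ξ => by
        ext u
        exact congrArg (fun D : F₀ →L[ℝ] F₁ => D u)
          ((mixedOne E₁ F₀ F₁ (fun g h => (Φ.alpha g : H.Der) h)).map_smul c ξ) }
  beta₁ := lieHomOfAction Φ.beta₁ Φ.pointedSmooth₂_beta₁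
  beta₀ := lieHomOfAction Φ.beta₀ Φ.pointedSmooth₂_beta₀
  alpha_leibniz ξ u v := by
    rw [lie_eq_mixedOne_conjMap]
    exact Φ.mixedOne_alpha_leibniz ξ u v
  bd_beta₁ x a := Φ.mixedOne_bd_beta₁ x a
  beta₁_act x u a := (mixedOne_equivariant H.pointedSmooth₂_act Φ.pointedSmooth₂_beta₀
    (by simp) Φ.pointedSmooth₂_beta₁ (by simp) Φ.pointedSmooth₂_beta₁
    (fun m g h => (Φ.beta₁_act m g h).symm) x u a).symm
  alpha_lie ξ η u := by
    rw [lie_eq_mixedOne_conjMap]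
    exact Φ.mixedOne_alpha_lie ξ η u
  beta₁_bd ξ a := Φ.mixedOne_beta₁_bd ξ a
  beta₀_bd ξ u := Φ.mixedOne_beta₀_bd ξ u
  alpha_act x ξ u := Φ.mixedOne_alpha_act x ξ u

theorem Action.isInfinitesimal_lieAlgebra (Φ : G.Action H) :
    Φ.IsInfinitesimal Φ.lieAlgebra where
  alpha_eq ξ u := (mixedDiffOne_eq_mixedOne Φ.pointedSmooth₂_alpha ξ u).symm
  beta₁_eq x a := (mixedDiffOne_eq_mixedOne Φ.pointedSmooth₂_beta₁ x a).symm
  beta₀_eq x u := (mixedDiffOne_eq_mixedOne Φ.pointedSmooth₂_beta₀ x u).symm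

/-- The differentials of a relative Rota-Baxter operator form a relative Rota-Baxter operator. -/
theorem Action.IsRelativeRotaBaxter.lieAlgebra {Φ : G.Action H} {B₁ : H₁ → G₁} {B₀ : H₀ → G₀}
    (hB : Φ.IsRelativeRotaBaxter B₁ B₀) :
    Φ.lieAlgebra.IsRelativeRotaBaxter (diffOne F₁ E₁ B₁) (diffOne F₀ E₀ B₀) := by
  have hB₁ : PointedSmooth F₁ E₁ B₁ := hB.rotaBaxter₁.pointedSmooth
  have hB₀ : PointedSmooth F₀ E₀ B₀ := hB.rotaBaxter₀.pointedSmooth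
  rw [diffOne_eq_toLinearMap hB₁, diffOne_eq_toLinearMap hB₀]
  refine ⟨fun a => ?_, fun a b => ?_, fun u v => ?_, fun u a => ?_⟩
  · have h := dOne_comp G.pointedSmooth_bd hB₁
    simp only [hB.bd_comm] at h
    rw [dOne_comp hB₀ H.pointedSmooth_bd] at h
    exact (congrArg (fun D : F₁ →L[ℝ] E₀ => D a) h).symm
  · have h := mixedOne_rotaBaxter (E := E₁) (F := F₁) (φ := Φ.beta₁.comp G.bd)
      (Φ.pointedSmooth₂_beta₁.comp G.pointedSmooth_bd pointedSmooth_id)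
      hB₁ hB.rotaBaxter₁.mul_eq
    have hβ : ∀ x a : F₁,
        mixedOne E₁ F₁ F₁ (fun g h => (Φ.beta₁.comp G.bd) g h) (dOne F₁ E₁ B₁ x) a =
          mixedOne E₀ F₁ F₁ (fun g h => Φ.beta₁ g h) (dOne E₁ E₀ G.bd (dOne F₁ E₁ B₁ x)) a :=
      fun x a => mixedOne_comp_left Φ.pointedSmooth₂_beta₁ G.pointedSmooth_bd _ a
    simp only [hβ] at h
    refine (lie_eq_mixedOne_conjMap (E := E₁) (G := G₁) (dOne F₁ E₁ B₁ a) (dOne F₁ E₁ B₁ b)).trans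
      ((h a b).trans ?_)
    rw [lie_eq_mixedOne_conjMap]
    rfl
  · refine (lie_eq_mixedOne_conjMap (E := E₀) (G := G₀) (dOne F₀ E₀ B₀ u) (dOne F₀ E₀ B₀ v)).trans
      ((mixedOne_rotaBaxter (E := E₀) (F := F₀) Φ.pointedSmooth₂_beta₀ hB₀
        hB.rotaBaxter₀.mul_eq u v).trans ?_)
    rw [lie_eq_mixedOne_conjMap]
    rfl
  · exact hB.mixedOne_mixed hB₁ hB₀ u a

end LieGroupCrossedModule

end

theorem mainTheorem6 {E₁ E₀ F₁ F₀ G₁ G₀ H₁ H₀ : Type*}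
    [NormedAddCommGroup E₁] [NormedSpace ℝ E₁] [CompleteSpace E₁]
    [NormedAddCommGroup E₀] [NormedSpace ℝ E₀] [CompleteSpace E₀]
    [NormedAddCommGroup F₁] [NormedSpace ℝ F₁] [CompleteSpace F₁]
    [NormedAddCommGroup F₀] [NormedSpace ℝ F₀] [CompleteSpace F₀]
    [TopologicalSpace G₁] [ChartedSpace E₁ G₁] [Group G₁] [LieGroup 𝓘(ℝ, E₁) ∞ G₁]
    [TopologicalSpace G₀] [ChartedSpace E₀ G₀] [Group G₀] [LieGroup 𝓘(ℝ, E₀) ∞ G₀]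
    [TopologicalSpace H₁] [ChartedSpace F₁ H₁] [Group H₁] [LieGroup 𝓘(ℝ, F₁) ∞ H₁]
    [TopologicalSpace H₀] [ChartedSpace F₀ H₀] [Group H₀] [LieGroup 𝓘(ℝ, F₀) ∞ H₀]
    (G : LieGroupCrossedModule E₁ E₀ G₁ G₀) (H : LieGroupCrossedModule F₁ F₀ H₁ H₀)
    (Φ : G.Action H) (B₁ : H₁ → G₁) (B₀ : H₀ → G₀)
    (hB : Φ.IsRelativeRotaBaxter B₁ B₀) :
    ∃ (𝔤 : LieAlgebraCrossedModule ℝ (GroupLieAlgebra 𝓘(ℝ, E₁) G₁)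
        (GroupLieAlgebra 𝓘(ℝ, E₀) G₀))
      (𝔥 : LieAlgebraCrossedModule ℝ (GroupLieAlgebra 𝓘(ℝ, F₁) H₁)
        (GroupLieAlgebra 𝓘(ℝ, F₀) H₀))
      (φ : 𝔤.Action 𝔥),
      G.IsInfinitesimal 𝔤 ∧ H.IsInfinitesimal 𝔥 ∧ Φ.IsInfinitesimal φ ∧
        φ.IsRelativeRotaBaxter (diffOne F₁ E₁ B₁) (diffOne F₀ E₀ B₀) :=
  ⟨G.lieAlgebra, H.lieAlgebra, Φ.lieAlgebra, G.isInfinitesimal_lieAlgebra,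
    H.isInfinitesimal_lieAlgebra, Φ.isInfinitesimal_lieAlgebra, hB.lieAlgebra⟩
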